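/- Let $p$ be a prime and let $m$ be the Haar measure on $\mathbb{Q}_p$ with $m(\mathbb{Z}_p)=1$. For $E=\mathbb{R},\mathbb{C},\mathbb{Q}_p$ let $\mathcal{D}(\mathbb{Q}_p,E)$ be the set of locally constant functions $\mathbb{Q}_p\to E$ with compact support. Let $\mathrm{Aff}$ be the group of pairs $g=(a,b)$, where $b\in\mathcal{D}(\mathbb{Q}_p,\mathbb{Q}_p)$ and $a:\mathbb{Q}_p\to\mathbb{Q}_p\setminus\{0\}$ is locally constant and equal to $1$ outside a compact set, with the product $(a,b)(a',b')=(aa',\,b+ab')$. For $g=(a,b)\in\mathrm{Aff}$ put $gx=(x+b(x))/a(x)$ for $x\in\mathbb{Q}_p$, $(gf)(x)=f(gx)$ for functions $f$ on $\mathbb{Q}_p$, and let $g^*m$ be the image of $m$ under $x\mapsto gx$, so that $\int f(gx)\,m(dx)=\int f\,d(g^*m)$. Let $\Gamma$ be the space of configurations, i.e. of subsets $\gamma\subset\mathbb{Q}_p$ having finitely many points in every compact set, with the Borel $\sigma$-algebra of the vague topology, which is the weakest topology making $\gamma\mapsto\langle f,\gamma\rangle=\sum_{x\in\gamma}f(x)$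 continuous for all $f\in\mathcal{D}(\mathbb{Q}_p,\mathbb{R})$. For a Radon measure $\sigma$ on $\mathbb{Q}_p$, the Poisson measure $\pi_\sigma$ with intensity $\sigma$ is the probability measure on $\Gamma$ for which the numbers of points of $\gamma$ in pairwise disjoint bounded Borel sets $\Lambda_1,\dots,\Lambda_n$ are independent Poisson variables with parameters $\sigma(\Lambda_1),\dots,\sigma(\Lambda_n)$. For a cylinder function $F(\gamma)=\psi(\langle f_1,\gamma\rangle,\dots,\langle f_n,\gamma\rangle)$, where either $f_j\in\mathcal{D}(\mathbb{Q}_p,\mathbb{R})$ and $\psi$ is a bounded continuous complex-valued function on $\mathbb{R}^n$, or $f_j\in\mathcal{D}(\mathbb{Q}_p,\mathbb{C})$ and $\psi$ is a complex polynomial, put $(V_gF)(\gamma)=\psi(\langle gf_1,\gamma\rangle,\dots,\langle gf_n,\gamma\rangle)$. For a measure $\pi$ on $\Gamma$, $V_g^*\pi$ denotes the measure $\nu$ on $\Gamma$ such that $\int V_gF\,d\pi=\int F\,d\nu$ for all these $F$ (where, for polynomial $\psi$, both integrands are required to be integrable). The Poisson measure $\pi_m$ exists and is unique, and for every $g\in\mathrm{Aff}$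 the following holds. 1. The Poisson measure $\pi_{g^*m}$ exists and is unique; $V_g^*\pi_m$ exists, is unique, and $V_g^*\pi_m=\pi_{g^*m}$. 2. $\pi_{g^*m}$ is absolutely continuous with respect to $\pi_m$, and its Radon–Nikodym derivative $R(g,\cdot)=d\pi_{g^*m}/d\pi_m$ is in $L^1(\pi_m)$. 3. $g^*m=\rho_g\,m$ with a density of the form $\rho_g=1_{\{|x|_p>R\}}+r$ for some $R>0$ and some $r\in\mathcal{D}(\mathbb{Q}_p,\mathbb{R})$ with $r\ge 0$. The function $1-\rho_g$ is $m$-integrable, for every $\gamma\in\Gamma$ only finitely many $x\in\gamma$ have $\rho_g(x)\ne1$, and $$R(g,\gamma)=\prod_{x\in\gamma}\rho_g(x)\cdot\exp\Big(\int_{\mathbb{Q}_p}(1-\rho_g)\,dm\Big)\qquad\text{for }\pi_m\text{-almost every }\gamma\in\Gamma.$$ -/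

import Mathlib

open MeasureTheory Topology

noncomputable section

namespace PadicPoisson

variable (p : ℕ) [Fact p.Prime]

/-- `ℚ_[p]` carries its Borel sigma-algebra. -/
instance instMeasurableSpacePadic : MeasurableSpace ℚ_[p] := borel ℚ_[p]

instance instBorelSpacePadic : BorelSpace ℚ_[p] := ⟨rfl⟩

/-- The ring of integers `ℤ_p`, as a compact subset of `ℚ_[p]` with non-empty interior. -/
def integerBall : TopologicalSpace.PositiveCompacts ℚ_[p] where
  carrier := Metric.closedBall 0 1
  isCompact' := isCompact_closedBall 0 1
  interior_nonempty' :=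
    ⟨0, Metric.ball_subset_interior_closedBall (Metric.mem_ball_self one_pos)⟩

/-- The Haar measure `m` on the additive group `ℚ_[p]` with `m(ℤ_p) = 1`. -/
def haar : Measure ℚ_[p] := Measure.addHaarMeasure (integerBall p)

variable {p}

/-- The functions in `𝓓(ℚ_p, E)`: locally constant with compact support. -/
structure IsTest {E : Type*} [Zero E] (f : ℚ_[p] → E) : Prop where
  locallyConstant : IsLocallyConstant f
  compactSupport : HasCompactSupport f

variable (p)

/-- The infinite-dimensional `p`-adic affine group: pairs `(a, b)` of locally constant functions
on `ℚ_[p]`, where `b` has compact support and `a` has no zeros and equals `1` outside a compact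
set. -/
@[ext]
structure Aff where
  a : ℚ_[p] → ℚ_[p]
  b : ℚ_[p] → ℚ_[p]
  a_locallyConstant : IsLocallyConstant a
  a_eq_one : HasCompactMulSupport a
  a_ne_zero : ∀ x, a x ≠ 0
  b_test : IsTest b

variable {p}

namespace Aff

/-- `(a, b) (a', b') = (a a', b + a b')`. -/
instance : Mul (Aff p) where
  mul g h :=
    { a := g.a * h.a
      b := g.b + g.a * h.b
      a_locallyConstant := g.a_locallyConstant.mul h.a_locallyConstant
      a_eq_one := g.a_eq_one.mul h.a_eq_one
      a_ne_zero := fun x => mul_ne_zero (g.a_ne_zero x) (h.a_ne_zero x)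
      b_test :=
        ⟨g.b_test.locallyConstant.add (g.a_locallyConstant.mul h.b_test.locallyConstant),
          g.b_test.compactSupport.add h.b_test.compactSupport.mul_left⟩ }

/-- The unit is `(1, 0)`. -/
instance : One (Aff p) where
  one :=
    { a := 1
      b := 0
      a_locallyConstant := IsLocallyConstant.const 1
      a_eq_one := HasCompactMulSupport.one
      a_ne_zero := fun _ => one_ne_zero
      b_test := ⟨IsLocallyConstant.const 0, HasCompactSupport.zero⟩ }

/-- `(a, b)⁻¹ = (a⁻¹, - a⁻¹ b)`. -/
instance : Inv (Aff p) where
  inv g :=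
    { a := g.a⁻¹
      b := -(g.a⁻¹ * g.b)
      a_locallyConstant := g.a_locallyConstant.inv
      a_eq_one := g.a_eq_one.comp_left (g := fun t : ℚ_[p] => t⁻¹) inv_one
      a_ne_zero := fun x => inv_ne_zero (g.a_ne_zero x)
      b_test :=
        ⟨(g.a_locallyConstant.inv.mul g.b_test.locallyConstant).neg,
          g.b_test.compactSupport.mul_left.neg⟩ }

theorem mul_a (g h : Aff p) : (g * h).a = g.a * h.a := rfl

theorem mul_b (g h : Aff p) : (g * h).b = g.b + g.a * h.b := rfl

theorem one_a : (1 : Aff p).a = 1 := rfl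

theorem one_b : (1 : Aff p).b = 0 := rfl

theorem inv_a (g : Aff p) : (g⁻¹).a = g.a⁻¹ := rfl

theorem inv_b (g : Aff p) : (g⁻¹).b = -(g.a⁻¹ * g.b) := rfl

instance : Group (Aff p) :=
  Group.ofLeftAxioms
    (fun g h k => by
      ext x
      · simp only [mul_a, mul_assoc]
      · simp only [mul_a, mul_b, Pi.add_apply, Pi.mul_apply]; ring)
    (fun g => by
      ext x
      · simp only [mul_a, one_a, one_mul]
      · simp only [mul_b, one_a, one_b, zero_add, one_mul])
    (fun g => by
      ext x
      · simp [mul_a, one_a, inv_a, g.a_ne_zero x]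
      · simp [mul_b, one_b, inv_a, inv_b])

/-- The motion `x ↦ g x = (x + b(x)) / a(x)` of points. -/
def act (g : Aff p) (x : ℚ_[p]) : ℚ_[p] := (x + g.b x) / g.a x

/-- The dual action on measures, `∫ f(g x) σ(dx) = ∫ f d(g^* σ)`: the image of `σ` under the
motion `x ↦ g x`. -/
def dual (g : Aff p) (σ : Measure ℚ_[p]) : Measure ℚ_[p] := σ.map g.act

end Aff

variable (p)

/-- The configuration space `Γ(ℚ_p)`: subsets of `ℚ_[p]` having finitely many points in every
compact set. -/
def Config : Type := {γ : Set ℚ_[p] // ∀ K : Set ℚ_[p], IsCompact K → (γ ∩ K).Finite}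

variable {p}

/-- `⟨f, γ⟩ = ∑_{x ∈ γ} f(x)`; the sum is finite if `f` has compact support. -/
def pairing {E : Type*} [AddCommMonoid E] (f : ℚ_[p] → E) (γ : Config p) : E :=
  ∑ᶠ x ∈ γ.1, f x

/-- The vague topology on `Γ(ℚ_p)`: the weakest one for which `γ ↦ ⟨f, γ⟩` is continuous for all
`f ∈ 𝓓(ℚ_p, ℝ)`. -/
instance instTopologicalSpaceConfig : TopologicalSpace (Config p) :=
  ⨅ f : {f : ℚ_[p] → ℝ // IsTest f}, TopologicalSpace.induced (pairing f.1) inferInstance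

/-- `Γ(ℚ_p)` carries the Borel sigma-algebra of the vague topology. -/
instance instMeasurableSpaceConfig : MeasurableSpace (Config p) := borel (Config p)

instance instBorelSpaceConfig : BorelSpace (Config p) := ⟨rfl⟩

/-- `π` is a Poisson measure on `Γ(ℚ_p)` with intensity `σ` (a Radon measure): a probability
measure for which the numbers of points in pairwise disjoint bounded Borel sets `Λ₁, …, Λₙ` are
independent Poisson variables with parameters `σ(Λ₁), …, σ(Λₙ)`. -/
structure IsPoisson (σ : Measure ℚ_[p]) (π : Measure (Config p)) : Prop where
  prob : IsProbabilityMeasure π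
  counts : ∀ (n : ℕ) (Λ : Fin n → Set ℚ_[p]),
    (∀ i, MeasurableSet (Λ i)) → (∀ i, Bornology.IsBounded (Λ i)) →
    (∀ i j, i ≠ j → Disjoint (Λ i) (Λ j)) →
    ∀ k : Fin n → ℕ,
      π {γ : Config p | ∀ i, (γ.1 ∩ Λ i).ncard = k i} =
        ∏ i, ProbabilityTheory.poissonMeasure (σ (Λ i)).toNNReal {k i}

/-- The Poisson measure `π_σ` on `Γ(ℚ_p)` with intensity `σ`. It is selected by its defining
property; that this property is satisfied by exactly one measure is asserted wherever `π_σ` is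
used. -/
def poisson (σ : Measure ℚ_[p]) : Measure (Config p) :=
  Classical.epsilon (IsPoisson σ)

/-- The cylinder function `F(γ) = ψ(⟨f₁, γ⟩, …, ⟨fₙ, γ⟩)`. -/
def cyl {E : Type*} [AddCommMonoid E] {n : ℕ} (f : Fin n → ℚ_[p] → E)
    (ψ : (Fin n → E) → ℂ) (γ : Config p) : ℂ :=
  ψ (fun j => pairing (f j) γ)

/-- `V_g F` for the cylinder function `F` given by `f` and `ψ`:
`(V_g F)(γ) = ψ(⟨g f₁, γ⟩, …, ⟨g fₙ, γ⟩)` with `(g f)(x) = f(g x)`. -/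
def moveCyl {E : Type*} [AddCommMonoid E] {n : ℕ} (g : Aff p) (f : Fin n → ℚ_[p] → E)
    (ψ : (Fin n → E) → ℂ) : Config p → ℂ :=
  cyl (fun j x => f j (g.act x)) ψ

/-- `ν = V_g^* π`: the relation `∫ V_g F dπ = ∫ F dν` holds for all bounded cylinder functions
and for all cylinder polynomials `F` (the latter being integrable). -/
structure IsDualMeasure (g : Aff p) (π ν : Measure (Config p)) : Prop where
  bounded : ∀ (n : ℕ) (f : Fin n → ℚ_[p] → ℝ), (∀ j, IsTest (f j)) →
    ∀ ψ : BoundedContinuousFunction (Fin n → ℝ) ℂ,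
      ∫ γ, moveCyl g f ψ γ ∂π = ∫ γ, cyl f ψ γ ∂ν
  polynomial : ∀ (n : ℕ) (f : Fin n → ℚ_[p] → ℂ), (∀ j, IsTest (f j)) →
    ∀ P : MvPolynomial (Fin n) ℂ,
      Integrable (moveCyl g f fun z => MvPolynomial.eval z P) π ∧
      Integrable (cyl f fun z => MvPolynomial.eval z P) ν ∧
      ∫ γ, moveCyl g f (fun z => MvPolynomial.eval z P) γ ∂π =
        ∫ γ, cyl f (fun z => MvPolynomial.eval z P) γ ∂ν

/-- `∏_{x ∈ γ} ρ(x) · exp(∫ (1 - ρ) dm)`; the product is finite if `ρ(x) ≠ 1` for only finitely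
many `x ∈ γ`. -/
def productDensity (ρ : ℚ_[p] → ℝ) (γ : Config p) : ℝ :=
  (∏ᶠ x ∈ γ.1, ρ x) * Real.exp (∫ x, (1 - ρ x) ∂(haar p))

end PadicPoisson

end

noncomputable section

@[to_additive]
theorem finprod_mem_eq_prod_pow_ncard {α M ι : Type*} [CommMonoid M] [Fintype ι] {s : Set α}
    {u : α → M} {c : ι → M} (hc : Function.Injective c) (hs : (s ∩ Function.mulSupport u).Finite)
    (hc1 : ∀ i, c i ≠ 1) (hu : ∀ x, u x ≠ 1 → ∃ i, c i = u x) :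
    ∏ᶠ x ∈ s, u x = ∏ i, c i ^ (s ∩ u ⁻¹' {c i}).ncard := by
  classical
  rw [finprod_mem_eq_prod u hs]
  have hmaps : ∀ x ∈ hs.toFinset, u x ∈ Finset.univ.image c := by
    intro x hx
    obtain ⟨i, hi⟩ := hu x ((hs.mem_toFinset.1 hx).2)
    exact Finset.mem_image.2 ⟨i, Finset.mem_univ _, hi⟩
  rw [← Finset.prod_fiberwise_of_maps_to hmaps, Finset.prod_image (fun _ _ _ _ h => hc h)]
  refine Finset.prod_congr rfl fun i _ => ?_
  rw [Finset.prod_congr rfl (g := fun _ => c i) (fun x hx => (Finset.mem_filter.1 hx).2),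
    Finset.prod_const, ← Set.ncard_coe_finset]
  congr 2
  ext x
  simp only [Finset.coe_filter, Set.Finite.mem_toFinset, Set.mem_inter_iff,
    Function.mem_mulSupport, Set.mem_ofPred_eq, Set.mem_preimage, Set.mem_singleton_iff]
  constructor
  · rintro ⟨⟨h1, -⟩, h2⟩
    exact ⟨h1, h2⟩
  · rintro ⟨h1, h2⟩
    exact ⟨⟨h1, h2 ▸ hc1 i⟩, h2⟩

/-- The values different from `1` of a function with finite range, enumerated. -/
@[to_additive]
theorem exists_enumeration_ne_one {α M : Type*} [One M] {u : α → M}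
    (hu : (Set.range u).Finite) :
    ∃ (n : ℕ) (c : Fin n → M), Function.Injective c ∧ (∀ i, c i ≠ 1) ∧
      ∀ x, u x ≠ 1 → ∃ i, c i = u x := by
  classical
  set S : Finset M := hu.toFinset.erase 1
  refine ⟨S.card, fun i => (S.equivFin.symm i : M), fun i j h => ?_, fun i => ?_, fun x hx => ?_⟩
  · exact S.equivFin.symm.injective (Subtype.ext h)
  · exact Finset.ne_of_mem_erase (S.equivFin.symm i).2
  · exact ⟨S.equivFin ⟨u x, Finset.mem_erase.2 ⟨hx, by simp⟩⟩, by simp⟩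

namespace PadicPoisson

variable {p : ℕ} [Fact p.Prime]

/-- The number of points of a configuration in a set. -/
def count (Λ : Set ℚ_[p]) (γ : Config p) : ℕ := (γ.1 ∩ Λ).ncard

theorem Config.finite_inter (γ : Config p) {Λ : Set ℚ_[p]} (h : Bornology.IsBounded Λ) :
    (γ.1 ∩ Λ).Finite :=
  (γ.2 _ h.isCompact_closure).subset (Set.inter_subset_inter_right _ subset_closure)

theorem count_biUnion {ι : Type*} (T : Finset ι) (B : ι → Set ℚ_[p])
    (hB : ∀ i ∈ T, Bornology.IsBounded (B i)) (hd : (T : Set ι).PairwiseDisjoint B)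
    (γ : Config p) : count (⋃ i ∈ T, B i) γ = ∑ i ∈ T, count (B i) γ := by
  classical
  induction T using Finset.induction_on with
  | empty => simp [count]
  | insert a T ha ih =>
    have hT : Bornology.IsBounded (⋃ i ∈ T, B i) :=
      (Bornology.isBounded_biUnion_finset T).2 fun i hi => hB i (Finset.mem_insert_of_mem hi)
    rw [Finset.sum_insert ha, ← ih (fun i hi => hB i (Finset.mem_insert_of_mem hi))
      (hd.subset (by simp)), Finset.set_biUnion_insert, count, count, count,
      Set.inter_union_distrib_left]
    refine Set.ncard_union_eq ?_ (γ.finite_inter (hB a (Finset.mem_insert_self _ _)))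
      (γ.finite_inter hT)
    refine Disjoint.mono Set.inter_subset_right Set.inter_subset_right ?_
    rw [Set.disjoint_iUnion₂_right]
    intro i hi
    exact hd (by simp) (by simp [hi]) (fun h => ha (h ▸ hi))

theorem isTest_finite_range {E : Type*} [Zero E] {f : ℚ_[p] → E} (hf : IsTest f) :
    (Set.range f).Finite := by
  let _ : TopologicalSpace E := ⊥
  have : DiscreteTopology E := ⟨rfl⟩
  have h1 : (f '' tsupport f).Finite :=
    (hf.compactSupport.image hf.locallyConstant.continuous).finite_of_discrete
  refine (h1.insert 0).subset ?_
  rintro _ ⟨x, rfl⟩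
  by_cases hx : x ∈ tsupport f
  · exact Or.inr ⟨x, hx, rfl⟩
  · exact Or.inl (image_eq_zero_of_notMem_tsupport hx)

theorem IsTest.isCompact_fiber {E : Type*} [Zero E] {f : ℚ_[p] → E} (hf : IsTest f) {c : E}
    (hc : c ≠ 0) : IsCompact (f ⁻¹' {c}) := by
  refine hf.compactSupport.of_isClosed_subset (hf.locallyConstant.isClosed_fiber c) ?_
  rintro x rfl
  exact subset_tsupport f hc

theorem isTest_indicator {E : Type*} [Zero E] (c : E) {U : Set ℚ_[p]} (hU : IsCompact U)
    (hU' : IsOpen U) : IsTest (U.indicator fun _ => c) := by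
  refine ⟨?_, ?_⟩
  · rw [IsLocallyConstant.iff_eventually_eq]
    intro x
    by_cases hx : x ∈ U
    · filter_upwards [hU'.mem_nhds hx] with y hy
      simp [hx, hy]
    · filter_upwards [hU.isClosed.isOpen_compl.mem_nhds hx] with y hy
      rw [Set.indicator_of_notMem hy, Set.indicator_of_notMem hx]
  · refine HasCompactSupport.intro hU fun x hx => ?_
    rw [Set.indicator_of_notMem hx]

theorem pairing_indicator_one {U : Set ℚ_[p]} (hU : Bornology.IsBounded U) (γ : Config p) :
    pairing (U.indicator fun _ => (1 : ℝ)) γ = count U γ := by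
  have h := finsum_mem_eq_sum_nsmul_ncard (s := γ.1) (u := U.indicator fun _ => (1 : ℝ))
    (c := fun _ : Unit => 1) (fun _ _ _ => rfl)
    ((γ.finite_inter hU).subset (Set.inter_subset_inter_right _ (by simp)))
    (fun _ => one_ne_zero) (fun x hx => ⟨(), by
      by_contra h
      by_cases hxU : x ∈ U <;> simp_all⟩)
  rw [pairing, h, count]
  simp only [Finset.univ_unique, Finset.sum_singleton, nsmul_eq_mul, mul_one]
  congr 3
  ext x
  by_cases hxU : x ∈ U <;> simp [hxU]

theorem continuous_pairing {f : ℚ_[p] → ℝ} (hf : IsTest f) :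
    Continuous (pairing f : Config p → ℝ) :=
  continuous_iff_le_induced.2 (iInf_le (fun f : {f : ℚ_[p] → ℝ // IsTest f} =>
    TopologicalSpace.induced (pairing f.1) inferInstance) ⟨f, hf⟩)

theorem continuous_count {U : Set ℚ_[p]} (hU : IsCompact U) (hU' : IsOpen U) :
    Continuous (count U : Config p → ℕ) := by
  rw [Nat.isClosedEmbedding_coe_real.isInducing.continuous_iff]
  have := continuous_pairing (isTest_indicator (1 : ℝ) hU hU')
  convert this using 1
  funext γ
  exact (pairing_indicator_one hU.isBounded γ).symm

theorem isCompact_ball (x : ℚ_[p]) {r : ℝ} : IsCompact (Metric.ball x r) :=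
  (isCompact_closedBall x r).of_isClosed_subset (IsUltrametricDist.isClosed_ball x r)
    Metric.ball_subset_closedBall

variable (p) in
/-- A countable family of balls which contains every small ball. -/
def ratBall (i : ℚ × ℕ) : Set ℚ_[p] := Metric.ball (i.1 : ℚ_[p]) (1 / (i.2 + 1))

theorem exists_ratBall_eq (x : ℚ_[p]) (n : ℕ) :
    ∃ q : ℚ, ratBall p (q, n) = Metric.ball x (1 / (n + 1)) := by
  obtain ⟨q, hq⟩ := (Padic.denseRange_ratCast p).exists_mem_open Metric.isOpen_ball
    ⟨x, Metric.mem_ball_self (show (0 : ℝ) < 1 / (n + 1) by positivity)⟩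
  exact ⟨q, (IsUltrametricDist.ball_eq_of_mem hq).symm⟩

/-- A compact open set is a finite disjoint union of balls of the countable family. -/
theorem exists_finset_ratBall {U : Set ℚ_[p]} (hU : IsCompact U) (hU' : IsOpen U) :
    ∃ T : Finset (ℚ × ℕ), (T : Set (ℚ × ℕ)).PairwiseDisjoint (ratBall p) ∧
      U = ⋃ i ∈ T, ratBall p i := by
  classical
  obtain ⟨δ, hδ, hδU⟩ := hU.exists_thickening_subset_open hU' subset_rfl
  obtain ⟨n, hn⟩ := exists_nat_one_div_lt hδ
  have hball : ∀ x ∈ U, Metric.ball x (1 / (n + 1 : ℝ)) ⊆ U := fun x hx =>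
    (Metric.ball_subset_ball hn.le).trans ((Metric.ball_subset_thickening hx δ).trans hδU)
  choose q hq using fun x : ℚ_[p] => exists_ratBall_eq x n
  obtain ⟨t, htU, ht⟩ := hU.elim_nhds_subcover (fun x => Metric.ball x (1 / (n + 1 : ℝ)))
    (fun x _ => Metric.ball_mem_nhds x (by positivity))
  -- choose one index for each of the finitely many distinct balls
  set S : Finset (Set ℚ_[p]) := t.image fun x => Metric.ball x (1 / (n + 1 : ℝ)) with hS
  have hS' : ∀ B ∈ S, ∃ x ∈ U, B = Metric.ball x (1 / (n + 1 : ℝ)) := by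
    intro B hB
    obtain ⟨x, hx, rfl⟩ := Finset.mem_image.1 hB
    exact ⟨x, htU x hx, rfl⟩
  have hidx : ∀ B : Set ℚ_[p], ∃ i : ℚ × ℕ, B ∈ S → ratBall p i = B := by
    intro B
    by_cases hB : B ∈ S
    · obtain ⟨x, -, rfl⟩ := hS' B hB
      exact ⟨(q x, n), fun _ => hq x⟩
    · exact ⟨(0, 0), fun h => absurd h hB⟩
  choose i hi using hidx
  refine ⟨S.image i, ?_, ?_⟩
  · intro a ha b hb hab
    obtain ⟨A, hA, rfl⟩ := Finset.mem_image.1 (Finset.mem_coe.1 ha)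
    obtain ⟨B, hB, rfl⟩ := Finset.mem_image.1 (Finset.mem_coe.1 hb)
    rw [Function.onFun, hi A hA, hi B hB]
    obtain ⟨x, -, hx⟩ := hS' A hA
    obtain ⟨y, -, hy⟩ := hS' B hB
    have hne : A ≠ B := fun h => hab (by rw [h])
    rw [hx, hy] at hne ⊢
    exact (IsUltrametricDist.ball_eq_or_disjoint x y _).resolve_left hne
  · rw [Finset.set_biUnion_finset_image]
    apply Set.Subset.antisymm
    · intro x hx
      obtain ⟨y, hy, hxy⟩ := Set.mem_iUnion₂.1 (ht hx)
      have hB : Metric.ball y (1 / (n + 1 : ℝ)) ∈ S := Finset.mem_image_of_mem _ hy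
      exact Set.mem_iUnion₂.2 ⟨_, hB, by rw [hi _ hB]; exact hxy⟩
    · refine Set.iUnion₂_subset fun B hB => ?_
      rw [hi B hB]
      obtain ⟨x, hx, rfl⟩ := hS' B hB
      exact hball x hx

theorem isBounded_ratBall (i : ℚ × ℕ) : Bornology.IsBounded (ratBall p i) := Metric.isBounded_ball

/-- The vague topology is induced by the numbers of points in countably many balls. -/
theorem isInducing_count_ratBall :
    IsInducing fun (γ : Config p) (i : ℚ × ℕ) => count (ratBall p i) γ := by
  refine ⟨le_antisymm ?_ ?_⟩
  · rw [← continuous_iff_le_induced]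
    exact continuous_pi fun i => continuous_count (isCompact_ball _) Metric.isOpen_ball
  · refine le_iInf fun f => ?_
    rw [← continuous_iff_le_induced]
    let τ : TopologicalSpace (Config p) := TopologicalSpace.induced
      (fun (γ : Config p) (i : ℚ × ℕ) => count (ratBall p i) γ) inferInstance
    have hΦ : Continuous[τ, _] fun (γ : Config p) (i : ℚ × ℕ) => count (ratBall p i) γ :=
      continuous_induced_dom
    have hcount : ∀ U : Set ℚ_[p], IsCompact U → IsOpen U →
        Continuous[τ, _] (count U : Config p → ℕ) := by
      intro U hU hU'
      obtain ⟨T, hT, rfl⟩ := exists_finset_ratBall hU hU'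
      have : (count (⋃ i ∈ T, ratBall p i) : Config p → ℕ) =
          (fun v : ℚ × ℕ → ℕ => ∑ i ∈ T, v i) ∘ fun γ i => count (ratBall p i) γ := by
        funext γ
        exact count_biUnion T _ (fun i _ => isBounded_ratBall i) hT γ
      rw [this]
      exact Continuous.comp (by fun_prop) hΦ
    obtain ⟨n, c, hc, hc0, hcf⟩ := exists_enumeration_ne_zero (isTest_finite_range f.2)
    have : (pairing f.1 : Config p → ℝ) =
        fun γ => ∑ i, count (f.1 ⁻¹' {c i}) γ • c i := by
      funext γ
      refine finsum_mem_eq_sum_nsmul_ncard hc ?_ hc0 hcf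
      exact (γ.finite_inter f.2.compactSupport.isBounded).subset
        (Set.inter_subset_inter_right _ (subset_tsupport _))
    rw [this]
    refine continuous_finsetSum _ fun i _ => ?_
    have h1 := hcount _ (f.2.isCompact_fiber (hc0 i)) (f.2.locallyConstant.isOpen_fiber (c i))
    exact Continuous.comp (g := fun k : ℕ => k • c i) continuous_of_discreteTopology h1

theorem measurableSpace_config_eq :
    (instMeasurableSpaceConfig : MeasurableSpace (Config p)) =
      MeasurableSpace.comap (fun (γ : Config p) (i : ℚ × ℕ) => count (ratBall p i) γ)
        MeasurableSpace.pi := by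
  have h := borel_comap (f := fun (γ : Config p) (i : ℚ × ℕ) => count (ratBall p i) γ)
    (t := Pi.topologicalSpace)
  rw [← isInducing_count_ratBall.eq_induced, ← BorelSpace.measurable_eq (α := ℚ × ℕ → ℕ)] at h
  exact h

theorem generateFrom_compact_open :
    (instMeasurableSpacePadic p : MeasurableSpace ℚ_[p]) =
      MeasurableSpace.generateFrom {U : Set ℚ_[p] | IsCompact U ∧ IsOpen U} := by
  have hb : TopologicalSpace.IsTopologicalBasis {U : Set ℚ_[p] | IsCompact U ∧ IsOpen U} := by
    refine TopologicalSpace.isTopologicalBasis_of_isOpen_of_nhds (fun U hU => hU.2) fun x V hx hV => ?_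
    obtain ⟨ε, hε, hεV⟩ := Metric.isOpen_iff.1 hV x hx
    exact ⟨Metric.ball x ε, ⟨isCompact_ball x, Metric.isOpen_ball⟩, Metric.mem_ball_self hε, hεV⟩
  exact hb.borel_eq_generateFrom

theorem count_restrict_apply (γ : Config p) (B Λ : Set ℚ_[p]) (hB : Bornology.IsBounded B)
    (hΛ : MeasurableSet Λ) :
    (Measure.count.restrict (γ.1 ∩ B)) Λ = count (B ∩ Λ) γ := by
  have hfin : (γ.1 ∩ (B ∩ Λ)).Finite := γ.finite_inter (hB.subset Set.inter_subset_left)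
  rw [Measure.restrict_apply hΛ, Set.inter_comm, Set.inter_assoc,
    Measure.count_apply_finite _ hfin, count, Set.ncard_eq_toFinset_card _ hfin]

theorem measurable_count {Λ : Set ℚ_[p]} (hΛ : MeasurableSet Λ) (hb : Bornology.IsBounded Λ) :
    Measurable (count Λ : Config p → ℕ) := by
  obtain ⟨R, hR⟩ := hb.subset_ball 0
  set B : Set ℚ_[p] := Metric.ball 0 R
  have hB : Bornology.IsBounded B := Metric.isBounded_ball
  have hfin : ∀ γ : Config p, IsFiniteMeasure (Measure.count.restrict (γ.1 ∩ B)) := fun γ =>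
    ⟨by rw [count_restrict_apply γ B _ hB MeasurableSet.univ]; exact ENNReal.natCast_lt_top _⟩
  have hcont : ∀ U : Set ℚ_[p], IsCompact U → IsOpen U →
      Measurable fun γ : Config p => (count (B ∩ U) γ : ENNReal) := fun U hU hU' =>
    measurable_from_nat.comp (continuous_count (hU.inter_left (IsUltrametricDist.isClosed_ball _ _))
      (Metric.isOpen_ball.inter hU')).measurable
  have hmeas : Measurable fun γ : Config p => Measure.count.restrict (γ.1 ∩ B) := by
    refine Measurable.measure_of_isPiSystem generateFrom_compact_open ?_ ?_ ?_
    · rintro U ⟨hU, hU'⟩ V ⟨hV, hV'⟩ -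
      exact ⟨hU.inter_right hV.isClosed, hU'.inter hV'⟩
    · rintro U ⟨hU, hU'⟩
      simp_rw [fun γ : Config p => count_restrict_apply γ B U hB hU'.measurableSet]
      exact hcont U hU hU'
    · simp_rw [fun γ : Config p => count_restrict_apply γ B _ hB MeasurableSet.univ]
      simpa using hcont B (isCompact_ball _) Metric.isOpen_ball
  have h := (Measure.measurable_coe hΛ).comp hmeas
  have h2 : (fun γ : Config p => (count Λ γ : ENNReal)) =
      (fun μ : Measure ℚ_[p] => μ Λ) ∘ fun γ : Config p => Measure.count.restrict (γ.1 ∩ B) := by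
    funext γ
    simp only [Function.comp]
    rw [count_restrict_apply γ B Λ hB hΛ, Set.inter_eq_right.2 hR]
  rw [← h2] at h
  have h3 := ENNReal.measurable_toReal.comp h
  have h4 : Measurable fun γ : Config p => ⌊(count Λ γ : ℝ)⌋₊ :=
    Nat.measurable_floor.comp (by simpa [Function.comp_def] using h3)
  simpa using h4

end PadicPoisson
end

noncomputable section

namespace ProbabilityTheory

theorem hasSum_pow_poissonMeasure (r : NNReal) (z : ℂ) :
    HasSum (fun n : ℕ => (Real.exp (-r) * r ^ n / n.factorial) • z ^ n)
      (Complex.exp (r * (z - 1))) := by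
  have h := (NormedSpace.expSeries_div_hasSum_exp ((r : ℂ) * z)).mul_left (Complex.exp (-r))
  rw [← Complex.exp_eq_exp_ℂ, ← Complex.exp_add] at h
  rw [show (r : ℂ) * (z - 1) = -r + r * z by ring]
  refine h.congr_fun fun n => ?_
  rw [Complex.real_smul]
  push_cast
  rw [mul_pow]
  ring

theorem integrable_pow_poissonMeasure (r : NNReal) (z : ℂ) :
    Integrable (fun n : ℕ => z ^ n) (poissonMeasure r) := by
  rw [integrable_poissonMeasure_iff]
  have h := (Real.summable_pow_div_factorial ((r : ℝ) * ‖z‖)).mul_left (Real.exp (-r))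
  refine h.congr fun n => ?_
  rw [norm_pow, mul_pow]
  ring

theorem integral_pow_poissonMeasure (r : NNReal) (z : ℂ) :
    ∫ n, z ^ n ∂(poissonMeasure r) = Complex.exp (r * (z - 1)) :=
  (hasSum_integral_poissonMeasure (integrable_pow_poissonMeasure r z)).unique
    (hasSum_pow_poissonMeasure r z)

end ProbabilityTheory

namespace PadicPoisson

open ProbabilityTheory

variable {p : ℕ} [Fact p.Prime]

/-- Functions with finitely many values and measurable fibres, equal to `1` off a bounded set. -/
structure IsStep {M : Type*} [One M] (u : ℚ_[p] → M) : Prop where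
  finite_range : (Set.range u).Finite
  bounded : Bornology.IsBounded (Function.mulSupport u)
  measurable_fiber : ∀ c, MeasurableSet (u ⁻¹' {c})

theorem IsStep.bounded_fiber {M : Type*} [One M] {u : ℚ_[p] → M} (hu : IsStep u) {c : M}
    (hc : c ≠ 1) : Bornology.IsBounded (u ⁻¹' {c}) :=
  hu.bounded.subset (by rintro x rfl; exact hc)

theorem IsStep.finite_inter {M : Type*} [One M] {u : ℚ_[p] → M} (hu : IsStep u) (γ : Config p) :
    (γ.1 ∩ Function.mulSupport u).Finite :=
  γ.finite_inter hu.bounded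

theorem IsStep.finprod_eq {M : Type*} [CommMonoid M] {u : ℚ_[p] → M} (hu : IsStep u)
    {n : ℕ} {c : Fin n → M} (hc : Function.Injective c) (hc1 : ∀ i, c i ≠ 1)
    (hcu : ∀ x, u x ≠ 1 → ∃ i, c i = u x) (γ : Config p) :
    ∏ᶠ x ∈ γ.1, u x = ∏ i, c i ^ count (u ⁻¹' {c i}) γ :=
  finprod_mem_eq_prod_pow_ncard hc (hu.finite_inter γ) hc1 hcu

theorem disjoint_preimage_singleton {α M : Type*} (u : α → M) {a b : M} (h : a ≠ b) :
    Disjoint (u ⁻¹' {a}) (u ⁻¹' {b}) :=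
  Disjoint.preimage u (Set.disjoint_singleton.2 h)

theorem IsStep.integral_sub_one {σ : Measure ℚ_[p]}
    (hσ : ∀ Λ : Set ℚ_[p], Bornology.IsBounded Λ → σ Λ ≠ ⊤) {u : ℚ_[p] → ℂ} (hu : IsStep u)
    {n : ℕ} {c : Fin n → ℂ} (hc : Function.Injective c) (hc1 : ∀ i, c i ≠ 1)
    (hcu : ∀ x, u x ≠ 1 → ∃ i, c i = u x) :
    Integrable (fun x => u x - 1) σ ∧
    ∫ x, (u x - 1) ∂σ = ∑ i, (σ.real (u ⁻¹' {c i}) : ℂ) * (c i - 1) := by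
  have h : (fun x => u x - 1) =
      fun x => ∑ i, (u ⁻¹' {c i}).indicator (fun _ => c i - 1) x := by
    funext x
    by_cases hx : u x = 1
    · rw [hx, sub_self, Finset.sum_eq_zero]
      intro i _
      refine Set.indicator_of_notMem ?_ _
      intro hi
      exact hc1 i (hi.symm.trans hx)
    · obtain ⟨i, hi⟩ := hcu x hx
      rw [Finset.sum_eq_single i]
      · rw [Set.indicator_of_mem (show x ∈ u ⁻¹' {c i} from hi.symm), hi]
      · intro j _ hj
        refine Set.indicator_of_notMem ?_ _
        intro hj'
        exact hj (hc (hj'.symm.trans hi.symm))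
      · simp
  have hint : ∀ i ∈ Finset.univ, Integrable ((u ⁻¹' {c i}).indicator (fun _ => c i - 1)) σ :=
    fun i _ => (integrable_indicator_iff (hu.measurable_fiber _)).2
      (integrableOn_const (hσ _ (hu.bounded_fiber (hc1 i))))
  rw [h]
  refine ⟨integrable_finsetSum _ hint, ?_⟩
  rw [integral_finsetSum _ hint]
  refine Finset.sum_congr rfl fun i _ => ?_
  rw [integral_indicator_const _ (hu.measurable_fiber _), Complex.real_smul]

theorem IsStep.integrable_sub_one {σ : Measure ℚ_[p]}
    (hσ : ∀ Λ : Set ℚ_[p], Bornology.IsBounded Λ → σ Λ ≠ ⊤) {u : ℚ_[p] → ℂ} (hu : IsStep u) :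
    Integrable (fun x => u x - 1) σ := by
  obtain ⟨n, c, hc, hc1, hcu⟩ := exists_enumeration_ne_one hu.finite_range
  exact (hu.integral_sub_one hσ hc hc1 hcu).1

theorem measurable_counts {ι : Type*} {Λ : ι → Set ℚ_[p]} (hm : ∀ i, MeasurableSet (Λ i))
    (hb : ∀ i, Bornology.IsBounded (Λ i)) :
    Measurable fun (γ : Config p) i => count (Λ i) γ :=
  measurable_pi_lambda _ fun i => measurable_count (hm i) (hb i)

theorem IsPoisson.map_counts {σ : Measure ℚ_[p]} {π : Measure (Config p)} (hπ : IsPoisson σ π)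
    {n : ℕ} {Λ : Fin n → Set ℚ_[p]} (hm : ∀ i, MeasurableSet (Λ i))
    (hb : ∀ i, Bornology.IsBounded (Λ i)) (hd : ∀ i j, i ≠ j → Disjoint (Λ i) (Λ j)) :
    π.map (fun γ i => count (Λ i) γ) =
      Measure.pi fun i => poissonMeasure (σ (Λ i)).toNNReal := by
  refine Measure.ext_of_singleton fun k => ?_
  rw [Measure.map_apply (measurable_counts hm hb) (measurableSet_singleton _),
    ← Set.univ_pi_singleton, Measure.pi_pi, ← hπ.counts n Λ hm hb hd k]
  congr 1
  ext γ
  simp [count]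

/-- The generating functional of a Poisson measure. -/
theorem IsPoisson.integral_finprod {σ : Measure ℚ_[p]} {π : Measure (Config p)}
    (hπ : IsPoisson σ π) (hσ : ∀ Λ : Set ℚ_[p], Bornology.IsBounded Λ → σ Λ ≠ ⊤)
    {u : ℚ_[p] → ℂ} (hu : IsStep u) :
    Integrable (fun γ : Config p => ∏ᶠ x ∈ γ.1, u x) π ∧
      ∫ γ, ∏ᶠ x ∈ γ.1, u x ∂π = Complex.exp (∫ x, (u x - 1) ∂σ) := by
  obtain ⟨n, c, hc, hc1, hcu⟩ := exists_enumeration_ne_one hu.finite_range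
  have hm : ∀ i, MeasurableSet (u ⁻¹' {c i}) := fun i => hu.measurable_fiber _
  have hb : ∀ i, Bornology.IsBounded (u ⁻¹' {c i}) := fun i => hu.bounded_fiber (hc1 i)
  have hlaw := hπ.map_counts hm hb (fun i j hij => disjoint_preimage_singleton u (hc.ne hij))
  have hmeas := (measurable_counts (p := p) hm hb).aemeasurable (μ := π)
  have hprod : (fun γ : Config p => ∏ᶠ x ∈ γ.1, u x) =
      (fun k : Fin n → ℕ => ∏ i, c i ^ k i) ∘ fun γ i => count (u ⁻¹' {c i}) γ := by
    funext γ
    exact hu.finprod_eq hc hc1 hcu γ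
  have hsm : AEStronglyMeasurable (fun k : Fin n → ℕ => ∏ i, c i ^ k i)
      (π.map fun γ i => count (u ⁻¹' {c i}) γ) :=
    (measurable_of_countable _).aestronglyMeasurable
  refine ⟨?_, ?_⟩
  · rw [hprod, ← integrable_map_measure hsm hmeas, hlaw]
    exact Integrable.fintype_prod (f := fun i k => c i ^ k)
      fun i => integrable_pow_poissonMeasure _ (c i)
  · have : ∫ γ, ∏ᶠ x ∈ γ.1, u x ∂π = ∫ γ, (fun k : Fin n → ℕ => ∏ i, c i ^ k i)
        ((fun (γ : Config p) i => count (u ⁻¹' {c i}) γ) γ) ∂π :=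
      congrArg (fun F : Config p → ℂ => ∫ γ, F γ ∂π) hprod
    rw [this, ← integral_map hmeas hsm, hlaw,
      integral_fintype_prod_eq_prod (fun i (k : ℕ) => c i ^ k),
      (hu.integral_sub_one hσ hc hc1 hcu).2, Complex.exp_sum]
    refine Finset.prod_congr rfl fun i _ => ?_
    rw [integral_pow_poissonMeasure]
    rfl

/-- The unimodular step function whose product over a configuration is the character
`exp (i ∑ k, t k * count (Λ k))`. -/
def phase {κ : Type*} [Fintype κ] (Λ : κ → Set ℚ_[p]) (t : κ → ℝ) (x : ℚ_[p]) : ℂ :=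
  Complex.exp ((∑ k, (Λ k).indicator (fun _ => t k) x : ℝ) * Complex.I)

section phase

variable {κ : Type*} [Fintype κ] {Λ : κ → Set ℚ_[p]}

theorem norm_phase (t : κ → ℝ) (x : ℚ_[p]) : ‖phase Λ t x‖ = 1 :=
  Complex.norm_exp_ofReal_mul_I _

theorem phase_eq_one {t : κ → ℝ} {x : ℚ_[p]} (hx : ∀ k, x ∉ Λ k) : phase Λ t x = 1 := by
  simp [phase, hx]

theorem isStep_phase (hm : ∀ k, MeasurableSet (Λ k)) (hb : ∀ k, Bornology.IsBounded (Λ k))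
    (t : κ → ℝ) : IsStep (phase Λ t) := by
  classical
  refine ⟨?_, ?_, ?_⟩
  · refine (Set.finite_range fun s : κ → Prop =>
      Complex.exp ((∑ k, if s k then t k else 0 : ℝ) * Complex.I)).subset ?_
    rintro _ ⟨x, rfl⟩
    exact ⟨fun k => x ∈ Λ k, by simp [phase, Set.indicator_apply]⟩
  · refine ((Bornology.isBounded_iUnion).2 hb).subset fun x hx => ?_
    by_contra h
    exact hx (phase_eq_one fun k hk => h (Set.mem_iUnion.2 ⟨k, hk⟩))
  · have : Measurable (phase Λ t) := by
      refine Complex.measurable_exp.comp (Measurable.mul_const (Complex.measurable_ofReal.comp ?_) _)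
      exact Finset.measurable_fun_sum _ fun k _ => measurable_const.indicator (hm k)
    exact fun c => this (measurableSet_singleton c)

theorem finprod_phase (hb : ∀ k, Bornology.IsBounded (Λ k)) (t : κ → ℝ) (γ : Config p) :
    ∏ᶠ x ∈ γ.1, phase Λ t x =
      Complex.exp ((∑ k, t k * count (Λ k) γ : ℝ) * Complex.I) := by
  classical
  have hfin : (γ.1 ∩ ⋃ k, Λ k).Finite := γ.finite_inter (Bornology.isBounded_iUnion.2 hb)
  rw [finprod_mem_eq_prod_of_inter_mulSupport_eq (t := hfin.toFinset)]
  · simp only [phase]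
    rw [← Complex.exp_sum, ← Finset.sum_mul, ← Complex.ofReal_sum, Finset.sum_comm]
    congr 3
    refine Finset.sum_congr rfl fun k _ => ?_
    rw [Finset.sum_indicator_eq_sum_filter, Finset.sum_const, nsmul_eq_mul, mul_comm, count,
      ← Set.ncard_coe_finset]
    congr 3
    ext x
    simp only [Finset.coe_filter, Set.Finite.mem_toFinset, Set.mem_inter_iff, Set.mem_iUnion,
      Set.mem_ofPred_eq]
    exact ⟨fun h => ⟨h.1.1, h.2⟩, fun h => ⟨⟨h.1, k, h.2⟩, h.2⟩⟩
  · ext x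
    simp only [Set.mem_inter_iff, Function.mem_mulSupport, Set.Finite.coe_toFinset, Set.mem_iUnion]
    refine ⟨fun h => ⟨⟨h.1, ?_⟩, h.2⟩, fun h => ⟨h.1.1, h.2⟩⟩
    by_contra hx
    exact h.2 (phase_eq_one fun k hk => hx ⟨k, hk⟩)

theorem integral_phase_sub_one {σ : Measure ℚ_[p]}
    (hσ : ∀ Λ : Set ℚ_[p], Bornology.IsBounded Λ → σ Λ ≠ ⊤)
    (hm : ∀ k, MeasurableSet (Λ k)) (hb : ∀ k, Bornology.IsBounded (Λ k))
    (hd : ∀ i j, i ≠ j → Disjoint (Λ i) (Λ j)) (t : κ → ℝ) :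
    ∫ x, (phase Λ t x - 1) ∂σ =
      ∑ k, (σ.real (Λ k) : ℂ) * (Complex.exp (t k * Complex.I) - 1) := by
  have h : ∀ x, phase Λ t x - 1 =
      ∑ k, (Λ k).indicator (fun _ => Complex.exp (t k * Complex.I) - 1) x := by
    intro x
    by_cases hx : ∃ k, x ∈ Λ k
    · obtain ⟨k, hk⟩ := hx
      have hj : ∀ j ∈ Finset.univ, j ≠ k → x ∉ Λ j := fun j _ hj hxj =>
        Set.disjoint_left.1 (hd j k hj) hxj hk
      rw [phase, Finset.sum_eq_single k (fun j h1 h2 => Set.indicator_of_notMem (hj j h1 h2) _)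
        (by simp), Finset.sum_eq_single k (fun j h1 h2 => Set.indicator_of_notMem (hj j h1 h2) _)
        (by simp), Set.indicator_of_mem hk, Set.indicator_of_mem hk]
    · push Not at hx
      rw [phase_eq_one hx, sub_self, Finset.sum_eq_zero]
      exact fun k _ => Set.indicator_of_notMem (hx k) _
  simp_rw [h]
  rw [integral_finsetSum]
  · refine Finset.sum_congr rfl fun k _ => ?_
    rw [integral_indicator_const _ (hm k), Complex.real_smul]
  · exact fun k _ => (integrable_indicator_iff (hm k)).2 (integrableOn_const (hσ _ (hb k)))

end phase

/-- A linear functional on a finite product of lines is given by coefficients. -/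
theorem strongDual_pi_apply {κ : Type*} [Fintype κ] [DecidableEq κ]
    (L : StrongDual ℝ (κ → ℝ)) (v : κ → ℝ) : L v = ∑ k, L (Pi.single k 1) * v k := by
  conv_lhs => rw [pi_eq_sum_univ' v]
  rw [map_sum]
  refine Finset.sum_congr rfl fun k _ => ?_
  rw [map_smul, smul_eq_mul, mul_comm]

theorem charFunDual_map_counts {κ : Type*} [Fintype κ] [DecidableEq κ] {Λ : κ → Set ℚ_[p]}
    (hm : ∀ k, MeasurableSet (Λ k)) (hb : ∀ k, Bornology.IsBounded (Λ k))
    (π : Measure (Config p)) (L : StrongDual ℝ (κ → ℝ)) :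
    charFunDual (π.map fun γ k => (count (Λ k) γ : ℝ)) L =
      ∫ γ, ∏ᶠ x ∈ γ.1, phase Λ (fun k => L (Pi.single k 1)) x ∂π := by
  rw [charFunDual_apply, integral_map]
  · refine integral_congr_ae (Filter.Eventually.of_forall fun γ => ?_)
    simp only
    rw [finprod_phase hb, strongDual_pi_apply L]
  · exact (measurable_pi_lambda _ fun k =>
      measurable_from_nat.comp (measurable_count (hm k) (hb k))).aemeasurable
  · exact (Continuous.aestronglyMeasurable (by fun_prop))

/-- A probability measure with the generating functional of `σ` on unimodular functions is the
Poisson measure with intensity `σ`. -/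
theorem isPoisson_of_integral_finprod {σ : Measure ℚ_[p]} {π : Measure (Config p)}
    [IsProbabilityMeasure π] (hσ : ∀ Λ : Set ℚ_[p], Bornology.IsBounded Λ → σ Λ ≠ ⊤)
    (h : ∀ u : ℚ_[p] → ℂ, IsStep u → (∀ x, ‖u x‖ = 1) →
      ∫ γ, ∏ᶠ x ∈ γ.1, u x ∂π = Complex.exp (∫ x, (u x - 1) ∂σ)) : IsPoisson σ π := by
  refine ⟨inferInstance, fun n Λ hm hb hd k => ?_⟩
  have hmeas : Measurable fun (γ : Config p) (i : Fin n) => (count (Λ i) γ : ℝ) :=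
    measurable_pi_lambda _ fun i => measurable_from_nat.comp (measurable_count (hm i) (hb i))
  have : IsProbabilityMeasure (π.map fun (γ : Config p) i => (count (Λ i) γ : ℝ)) :=
    Measure.isProbabilityMeasure_map hmeas.aemeasurable
  have hlaw : (π.map fun (γ : Config p) i => (count (Λ i) γ : ℝ)) =
      Measure.pi fun i => (poissonMeasure (σ (Λ i)).toNNReal).map (Nat.cast : ℕ → ℝ) := by
    rw [← charFunDual_eq_pi_iff]
    intro L
    rw [charFunDual_map_counts hm hb, h _ (isStep_phase hm hb _) (norm_phase _),
      integral_phase_sub_one hσ hm hb hd, Complex.exp_sum]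
    refine Finset.prod_congr rfl fun i _ => ?_
    rw [charFunDual_eq_charFun_map_one, Measure.map_map (by fun_prop) (by fun_prop),
      charFun_apply_real, integral_map (by fun_prop) (by fun_prop)]
    have : ∀ m : ℕ, Complex.exp (((1 : ℝ) : ℂ) *
        (((L.comp (.single ℝ (fun _ => ℝ) i)) ∘ (Nat.cast : ℕ → ℝ)) m : ℝ) * Complex.I) =
        Complex.exp (L (Pi.single i 1) * Complex.I) ^ m := by
      intro m
      rw [← Complex.exp_nat_mul]
      congr 1
      have h1 : L (Pi.single i (m : ℝ)) = m * L (Pi.single i 1) := by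
        rw [← smul_eq_mul, ← map_smul, ← Pi.single_smul]
        simp
      simp [h1]
      ring
    simp_rw [this]
    rw [integral_pow_poissonMeasure]
    rfl
  have hk := congrArg (fun ν => ν {fun i => (k i : ℝ)}) hlaw
  rw [Measure.map_apply hmeas (measurableSet_singleton _), ← Set.univ_pi_singleton,
    Measure.pi_pi] at hk
  convert hk using 1
  · congr 1
    ext γ
    simp [count]
  · refine Finset.prod_congr rfl fun i _ => ?_
    rw [Measure.map_apply (by fun_prop) (measurableSet_singleton _)]
    congr 1
    ext m
    simp

/-- A probability measure on configurations is determined by the characteristic functions of the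
numbers of points in finitely many balls. -/
theorem ext_of_integral_finprod_phase {μ ν : Measure (Config p)} [IsProbabilityMeasure μ]
    [IsProbabilityMeasure ν]
    (h : ∀ (I : Finset (ℚ × ℕ)) (t : I → ℝ),
      ∫ γ, ∏ᶠ x ∈ γ.1, phase (fun k : I => ratBall p k) t x ∂μ =
        ∫ γ, ∏ᶠ x ∈ γ.1, phase (fun k : I => ratBall p k) t x ∂ν) : μ = ν := by
  classical
  have hmB : ∀ i, MeasurableSet (ratBall p i) := fun i => Metric.isOpen_ball.measurableSet
  set Φ : Config p → ℚ × ℕ → ℝ := fun γ i => count (ratBall p i) γ with hΦdef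
  have hΦ : Measurable Φ := measurable_pi_lambda _ fun i =>
    measurable_from_nat.comp (measurable_count (hmB i) (isBounded_ratBall i))
  have hΦI : ∀ I : Finset (ℚ × ℕ), Measurable fun (γ : Config p) (k : I) =>
      (count (ratBall p k) γ : ℝ) := fun I => measurable_pi_lambda _ fun k =>
    measurable_from_nat.comp (measurable_count (hmB k) (isBounded_ratBall k))
  have hmap : μ.map Φ = ν.map Φ := by
    have hI : ∀ I : Finset (ℚ × ℕ), (μ.map Φ).map I.restrict = (ν.map Φ).map I.restrict := by
      intro I
      rw [Measure.map_map (Finset.measurable_restrict I) hΦ,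
        Measure.map_map (Finset.measurable_restrict I) hΦ]
      have h1 : I.restrict ∘ Φ = fun (γ : Config p) (k : I) => (count (ratBall p k) γ : ℝ) := rfl
      rw [h1]
      have := Measure.isProbabilityMeasure_map (μ := μ) (hΦI I).aemeasurable
      have := Measure.isProbabilityMeasure_map (μ := ν) (hΦI I).aemeasurable
      refine Measure.ext_of_charFunDual (funext fun L => ?_)
      rw [charFunDual_map_counts (Λ := fun k : I => ratBall p k) (fun k => hmB k)
          (fun k => isBounded_ratBall _),
        charFunDual_map_counts (Λ := fun k : I => ratBall p k) (fun k => hmB k)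
          (fun k => isBounded_ratBall _), h]
    have := Measure.isProbabilityMeasure_map (μ := ν) hΦ.aemeasurable
    exact IsProjectiveLimit.unique (P := fun I => (ν.map Φ).map I.restrict) hI (fun I => rfl)
  refine Measure.ext fun s hs => ?_
  rw [measurableSpace_config_eq] at hs
  obtain ⟨S, hS, rfl⟩ := hs
  have hS' : MeasurableSet ((fun (v : ℚ × ℕ → ℝ) i => ⌊v i⌋₊) ⁻¹' S) :=
    (measurable_pi_lambda _ fun i => Nat.measurable_floor.comp (measurable_pi_apply i)) hS
  have := congrArg (fun m => m ((fun (v : ℚ × ℕ → ℝ) i => ⌊v i⌋₊) ⁻¹' S)) hmap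
  rw [Measure.map_apply hΦ hS', Measure.map_apply hΦ hS'] at this
  simpa [← Set.preimage_comp, Function.comp_def, hΦdef] using this

theorem IsPoisson.unique {σ : Measure ℚ_[p]} {μ ν : Measure (Config p)}
    (hσ : ∀ Λ : Set ℚ_[p], Bornology.IsBounded Λ → σ Λ ≠ ⊤)
    (hμ : IsPoisson σ μ) (hν : IsPoisson σ ν) : μ = ν := by
  have := hμ.prob
  have := hν.prob
  refine ext_of_integral_finprod_phase fun I t => ?_
  have hu := isStep_phase (Λ := fun k : I => ratBall p k)
    (fun k => Metric.isOpen_ball.measurableSet) (fun k => isBounded_ratBall _) t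
  rw [(hμ.integral_finprod hσ hu).2, (hν.integral_finprod hσ hu).2]

section sampling

/-- The product of `u` over the first `y.1` points of the sequence `y.2`. -/
@[to_additive]
def samplesProd {α M : Type*} [CommMonoid M] (u : α → M) (y : ℕ × (ℕ → α)) : M :=
  ∏ j ∈ Finset.range y.1, u (y.2 j)

@[to_additive]
theorem measurable_samplesProd {α M : Type*} [CommMonoid M] [MeasurableSpace α]
    [MeasurableSpace M] [MeasurableMul₂ M] {u : α → M} (hu : Measurable u) :
    Measurable (samplesProd u) := by
  refine measurable_from_prod_countable_right fun N => ?_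
  exact Finset.measurable_fun_prod (Finset.range N) fun j _ => hu.comp (measurable_pi_apply j)

/-- The number of points is Poisson, and the points are independent with law `ν`. -/
def samplesMeasure {α : Type*} [MeasurableSpace α] (r : NNReal) (ν : Measure α) :
    Measure (ℕ × (ℕ → α)) :=
  (poissonMeasure r).prod (Measure.infinitePi fun _ : ℕ => ν)

instance {α : Type*} [MeasurableSpace α] (r : NNReal) (ν : Measure α) [IsProbabilityMeasure ν] :
    IsProbabilityMeasure (samplesMeasure r ν) := by
  unfold samplesMeasure
  infer_instance

theorem integral_samplesProd {α : Type*} [MeasurableSpace α] (r : NNReal) (ν : Measure α)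
    [IsProbabilityMeasure ν] {u : α → ℂ} (hu : Measurable u) (hu1 : ∀ x, ‖u x‖ = 1) :
    ∫ y, samplesProd u y ∂(samplesMeasure r ν) = Complex.exp (r * (∫ x, u x ∂ν - 1)) := by
  have hint : Integrable (samplesProd u) (samplesMeasure r ν) := by
    refine Integrable.of_bound (measurable_samplesProd hu).aestronglyMeasurable 1
      (Filter.Eventually.of_forall fun y => ?_)
    simp [samplesProd, norm_prod, hu1]
  rw [samplesMeasure] at hint ⊢
  rw [integral_prod _ hint, ← integral_pow_poissonMeasure]
  refine integral_congr_ae (Filter.Eventually.of_forall fun k => ?_)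
  simp only [samplesProd]
  have h := integral_restrict_infinitePi (μ := fun _ : ℕ => ν) (s := Finset.range k)
    (f := fun z => ∏ j, u (z j)) (Finset.measurable_fun_prod _ fun j _ =>
      hu.comp (measurable_pi_apply j)).aestronglyMeasurable
  rw [integral_fintype_prod_eq_prod (fun _ x => u x)] at h
  simp only [Finset.restrict_def, Finset.prod_const, Finset.card_univ, Fintype.card_coe,
    Finset.card_range] at h
  rw [← h]
  refine integral_congr_ae (Filter.Eventually.of_forall fun x => ?_)
  exact (Finset.prod_coe_sort (Finset.range k) fun j => u (x j)).symm

theorem ae_mem_samples {α : Type*} [MeasurableSpace α] (r : NNReal) {ν : Measure α}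
    [IsProbabilityMeasure ν] {A : Set α} (hA : ∀ᵐ x ∂ν, x ∈ A) :
    ∀ᵐ y ∂(samplesMeasure r ν), ∀ j, y.2 j ∈ A := by
  rw [ae_all_iff]
  intro j
  have h1 : MeasurePreserving (fun y : ℕ × (ℕ → α) => y.2 j) (samplesMeasure r ν) ν :=
    (measurePreserving_eval_infinitePi (fun _ : ℕ => ν) j).comp measurePreserving_snd
  exact h1.quasiMeasurePreserving.ae hA

theorem ae_ne_samples {α : Type*} [MeasurableSpace α] [MeasurableEq α] (r : NNReal)
    {ν : Measure α} [IsProbabilityMeasure ν] [NullSingletonClass ν] :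
    ∀ᵐ y ∂(samplesMeasure r ν), ∀ j k, j ≠ k → y.2 j ≠ y.2 k := by
  have hdiag : ∀ᵐ z ∂(ν.prod ν), z.1 ≠ z.2 := by
    have hm : MeasurableSet {z : α × α | z.1 = z.2} :=
      measurableSet_eq_fun measurable_fst measurable_snd
    have h0 : (ν.prod ν) {z : α × α | z.1 = z.2} = 0 := by
      rw [Measure.measure_prod_null hm]
      refine Filter.Eventually.of_forall fun x => ?_
      have : Prod.mk x ⁻¹' {z : α × α | z.1 = z.2} = {x} := by
        ext y
        simp [eq_comm]
      simp only [this, measure_singleton, Pi.zero_apply]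
    rw [ae_iff]
    simpa using h0
  simp_rw [ae_all_iff]
  intro j k hjk
  have h1 : MeasurePreserving (fun x : ℕ → α => (x j, x k))
      (Measure.infinitePi fun _ : ℕ => ν) (ν.prod ν) :=
    ⟨by fun_prop, Measure.infinitePi_map_eval_prod (P := fun _ : ℕ => ν) hjk⟩
  have h2 : MeasurePreserving (fun y : ℕ × (ℕ → α) => (y.2 j, y.2 k)) (samplesMeasure r ν)
      (ν.prod ν) := h1.comp measurePreserving_snd
  exact h2.quasiMeasurePreserving.ae hdiag

end sampling

section superposition

variable {ι : Type*} {A : ι → Set ℚ_[p]}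

/-- The samples for which the points of the `i`-th sequence are distinct and lie in `A i`. -/
def goodSamples (A : ι → Set ℚ_[p]) : Set (ι → ℕ × (ℕ → ℚ_[p])) :=
  {ω | ∀ i, (∀ j, (ω i).2 j ∈ A i) ∧ ∀ j k, j ≠ k → (ω i).2 j ≠ (ω i).2 k}

/-- All points of the sample. -/
def samplePoints (ω : ι → ℕ × (ℕ → ℚ_[p])) : Set ℚ_[p] :=
  {x | ∃ i, ∃ j < (ω i).1, (ω i).2 j = x}

theorem mem_image_sigma_of_mem_samplePoints {ω : ι → ℕ × (ℕ → ℚ_[p])} (hω : ω ∈ goodSamples A)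
    {B : Set ℚ_[p]} {F : Finset ι} (hF : ∀ i, (A i ∩ B).Nonempty → i ∈ F) {x : ℚ_[p]}
    (hx : x ∈ samplePoints ω) (hxB : x ∈ B) :
    ∃ z ∈ F.sigma fun i => Finset.range (ω i).1, (ω z.1).2 z.2 = x := by
  obtain ⟨i, j, hj, rfl⟩ := hx
  exact ⟨⟨i, j⟩, Finset.mem_sigma.2 ⟨hF i ⟨_, (hω i).1 j, hxB⟩, Finset.mem_range.2 hj⟩, rfl⟩

theorem finite_samplePoints_inter {ω : ι → ℕ × (ℕ → ℚ_[p])} (hω : ω ∈ goodSamples A)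
    {B : Set ℚ_[p]} (hB : {i | (A i ∩ B).Nonempty}.Finite) : (samplePoints ω ∩ B).Finite := by
  classical
  refine (((hB.toFinset.sigma fun i => Finset.range (ω i).1).image
    fun z => (ω z.1).2 z.2).finite_toSet).subset ?_
  rintro x ⟨hx, hxB⟩
  obtain ⟨z, hz, hzx⟩ := mem_image_sigma_of_mem_samplePoints hω
    (F := hB.toFinset) (fun i hi => hB.mem_toFinset.2 hi) hx hxB
  exact Finset.mem_coe.2 (Finset.mem_image.2 ⟨z, hz, hzx⟩)

@[to_additive]
theorem finprod_samplePoints {M : Type*} [CommMonoid M]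
    (hA : Pairwise fun i j => Disjoint (A i) (A j))
    {ω : ι → ℕ × (ℕ → ℚ_[p])} (hω : ω ∈ goodSamples A) {u : ℚ_[p] → M}
    {F : Finset ι} (hF : ∀ i, (A i ∩ Function.mulSupport u).Nonempty → i ∈ F) :
    ∏ᶠ x ∈ samplePoints ω, u x = ∏ i ∈ F, samplesProd u (ω i) := by
  classical
  have hinj : Set.InjOn (fun z : (_ : ι) × ℕ => (ω z.1).2 z.2)
      (F.sigma fun i => Finset.range (ω i).1 : Finset ((_ : ι) × ℕ)) := by
    rintro ⟨i, j⟩ - ⟨i', j'⟩ - h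
    simp only at h
    have hii : i = i' := by
      by_contra hne
      exact Set.disjoint_left.1 (hA hne) ((hω i).1 j) (h ▸ (hω i').1 j')
    subst hii
    by_contra hne
    exact (hω i).2 j j' (fun hj => hne (by rw [hj])) h
  rw [finprod_mem_eq_prod_of_inter_mulSupport_eq
    (t := (F.sigma fun i => Finset.range (ω i).1).image fun z => (ω z.1).2 z.2),
    Finset.prod_image hinj, Finset.prod_sigma]
  · rfl
  · ext x
    simp only [Set.mem_inter_iff, Finset.coe_image, Set.mem_image, Finset.mem_coe]
    refine ⟨fun h => ⟨mem_image_sigma_of_mem_samplePoints hω hF h.1 h.2, h.2⟩, ?_⟩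
    rintro ⟨⟨z, hz, rfl⟩, hx⟩
    exact ⟨⟨z.1, z.2, Finset.mem_range.1 (Finset.mem_sigma.1 hz).2, rfl⟩, hx⟩

variable (hloc : ∀ B : Set ℚ_[p], Bornology.IsBounded B → {i | (A i ∩ B).Nonempty}.Finite)

/-- A configuration from its set of points. -/
def Config.ofSet (s : Set ℚ_[p]) (hs : ∀ K : Set ℚ_[p], IsCompact K → (s ∩ K).Finite) :
    Config p := ⟨s, hs⟩

open Classical in
/-- The configuration formed by all points of a good sample. -/
def sampleConfig (hloc : ∀ B : Set ℚ_[p], Bornology.IsBounded B →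
    {i | (A i ∩ B).Nonempty}.Finite) (ω : ι → ℕ × (ℕ → ℚ_[p])) : Config p :=
  if hω : ω ∈ goodSamples A then
    .ofSet (samplePoints ω) fun K hK => finite_samplePoints_inter hω (hloc K hK.isBounded)
  else .ofSet ∅ fun K _ => by simp

theorem sampleConfig_of_mem {ω : ι → ℕ × (ℕ → ℚ_[p])} (hω : ω ∈ goodSamples A) :
    (sampleConfig hloc ω).1 = samplePoints ω := by
  rw [sampleConfig, dif_pos hω, Config.ofSet]

theorem sampleConfig_of_notMem {ω : ι → ℕ × (ℕ → ℚ_[p])} (hω : ω ∉ goodSamples A) :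
    (sampleConfig hloc ω).1 = ∅ := by
  rw [sampleConfig, dif_neg hω, Config.ofSet]

theorem measurableSet_goodSamples [Countable ι] (hAm : ∀ i, MeasurableSet (A i)) :
    MeasurableSet (goodSamples A) := by
  have : goodSamples A = ⋂ i, ((⋂ j, {ω : ι → ℕ × (ℕ → ℚ_[p]) | (ω i).2 j ∈ A i}) ∩
      ⋂ j, ⋂ k, ⋂ _ : j ≠ k, {ω : ι → ℕ × (ℕ → ℚ_[p]) | (ω i).2 j = (ω i).2 k}ᶜ) := by
    ext ω
    simp [goodSamples]
  rw [this]
  have hc : ∀ i j, Measurable fun ω : ι → ℕ × (ℕ → ℚ_[p]) => (ω i).2 j := fun i j => by fun_prop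
  refine MeasurableSet.iInter fun i => (MeasurableSet.iInter fun j => hc i j (hAm i)).inter
    (MeasurableSet.iInter fun j => MeasurableSet.iInter fun k => MeasurableSet.iInter fun _ => ?_)
  exact (measurableSet_eq_fun (hc i j) (hc i k)).compl

theorem measurable_sampleConfig [Countable ι] (hAm : ∀ i, MeasurableSet (A i))
    (hA : Pairwise fun i j => Disjoint (A i) (A j)) : Measurable (sampleConfig hloc) := by
  classical
  rw [measurable_iff_comap_le, measurableSpace_config_eq, MeasurableSpace.comap_comp,
    ← measurable_iff_comap_le]
  refine measurable_pi_lambda _ fun b => ?_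
  have hb : Bornology.IsBounded (ratBall p b) := isBounded_ratBall b
  set f : ℚ_[p] → ℝ := (ratBall p b).indicator fun _ => 1
  have hf : Measurable f := measurable_const.indicator Metric.isOpen_ball.measurableSet
  have hcount : ∀ ω, (count (ratBall p b) (sampleConfig hloc ω) : ℝ) =
      (goodSamples A).indicator (fun ω => ∑ i ∈ (hloc _ hb).toFinset, samplesSum f (ω i)) ω := by
    intro ω
    rw [← pairing_indicator_one hb, pairing]
    by_cases hω : ω ∈ goodSamples A
    · rw [Set.indicator_of_mem hω, sampleConfig_of_mem hloc hω]
      refine finsum_samplePoints hA hω fun i hi => (hloc _ hb).mem_toFinset.2 ?_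
      exact hi.mono (Set.inter_subset_inter_right _ Set.support_indicator_subset)
    · rw [Set.indicator_of_notMem hω, sampleConfig_of_notMem hloc hω]
      simp
  have hm : Measurable fun ω => (count (ratBall p b) (sampleConfig hloc ω) : ℝ) := by
    simp_rw [hcount]
    exact Measurable.indicator (Finset.measurable_fun_sum _ fun i _ =>
      (measurable_samplesSum hf).comp (measurable_pi_apply i)) (measurableSet_goodSamples hAm)
  simpa [Function.comp_def] using Nat.measurable_floor.comp hm

theorem ae_mem_goodSamples [Countable ι] {r : ι → NNReal} {ν : ι → Measure ℚ_[p]}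
    [∀ i, IsProbabilityMeasure (ν i)] [∀ i, NullSingletonClass (ν i)] (hν : ∀ i, ∀ᵐ x ∂(ν i), x ∈ A i) :
    ∀ᵐ ω ∂(Measure.infinitePi fun i => samplesMeasure (r i) (ν i)), ω ∈ goodSamples A := by
  have : ∀ᵐ ω ∂(Measure.infinitePi fun i => samplesMeasure (r i) (ν i)), ∀ i,
      (∀ j, (ω i).2 j ∈ A i) ∧ ∀ j k, j ≠ k → (ω i).2 j ≠ (ω i).2 k := by
    rw [ae_all_iff]
    intro i
    exact (measurePreserving_eval_infinitePi (fun i => samplesMeasure (r i) (ν i))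
      i).quasiMeasurePreserving.ae ((ae_mem_samples (r i) (hν i)).and (ae_ne_samples (r i)))
  exact this

theorem integral_finprod_sampleConfig [Countable ι] (hAm : ∀ i, MeasurableSet (A i))
    (hA : Pairwise fun i j => Disjoint (A i) (A j)) {r : ι → NNReal} {ν : ι → Measure ℚ_[p]}
    [∀ i, IsProbabilityMeasure (ν i)] [∀ i, NullSingletonClass (ν i)] (hν : ∀ i, ∀ᵐ x ∂(ν i), x ∈ A i)
    {u : ℚ_[p] → ℂ} (hu : IsStep u) (hum : Measurable u) (hu1 : ∀ x, ‖u x‖ = 1)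
    (hsm : AEStronglyMeasurable (fun γ : Config p => ∏ᶠ x ∈ γ.1, u x)
      ((Measure.infinitePi fun i => samplesMeasure (r i) (ν i)).map (sampleConfig hloc))) :
    ∫ γ, ∏ᶠ x ∈ γ.1, u x
        ∂((Measure.infinitePi fun i => samplesMeasure (r i) (ν i)).map (sampleConfig hloc)) =
      ∏ i ∈ (hloc _ hu.bounded).toFinset, Complex.exp (r i * (∫ x, u x ∂(ν i) - 1)) := by
  rw [integral_map (measurable_sampleConfig hloc hAm hA).aemeasurable hsm]
  set F := (hloc _ hu.bounded).toFinset
  have h1 : ∀ᵐ ω ∂(Measure.infinitePi fun i => samplesMeasure (r i) (ν i)),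
      ∏ᶠ x ∈ (sampleConfig hloc ω).1, u x =
        (fun z : (F → ℕ × (ℕ → ℚ_[p])) => ∏ i, samplesProd u (z i)) (F.restrict ω) := by
    filter_upwards [ae_mem_goodSamples hν] with ω hω
    rw [sampleConfig_of_mem hloc hω, finprod_samplePoints hA hω (F := F)
      (fun i hi => (hloc _ hu.bounded).mem_toFinset.2 hi)]
    exact (Finset.prod_coe_sort F fun i => samplesProd u (ω i)).symm
  rw [integral_congr_ae h1, integral_restrict_infinitePi
    (μ := fun i => samplesMeasure (r i) (ν i)) (f := fun z => ∏ i, samplesProd u (z i))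
    (Finset.measurable_fun_prod _ fun i _ =>
      (measurable_samplesProd hum).comp (measurable_pi_apply i)).aestronglyMeasurable,
    integral_fintype_prod_eq_prod (fun _ y => samplesProd u y),
    ← Finset.prod_coe_sort F]
  exact Finset.prod_congr rfl fun i _ => integral_samplesProd _ _ hum hu1

end superposition

theorem IsStep.measurableSet_preimage {M : Type*} [One M] {u : ℚ_[p] → M} (hu : IsStep u)
    (S : Set M) : MeasurableSet (u ⁻¹' S) := by
  have : u ⁻¹' S = ⋃ c ∈ Set.range u ∩ S, u ⁻¹' {c} := by
    ext x
    simp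
  rw [this]
  exact (hu.finite_range.subset Set.inter_subset_left).measurableSet_biUnion
    fun c _ => hu.measurable_fiber c

theorem IsStep.measurable {M : Type*} [One M] [MeasurableSpace M]
    {u : ℚ_[p] → M} (hu : IsStep u) : Measurable u :=
  fun S _ => hu.measurableSet_preimage S

theorem IsStep.measurable_finprod {M : Type*} [CommMonoid M] [MeasurableSpace M]
    [MeasurableMul₂ M] {u : ℚ_[p] → M} (hu : IsStep u) :
    Measurable fun γ : Config p => ∏ᶠ x ∈ γ.1, u x := by
  obtain ⟨n, c, hc, hc1, hcu⟩ := exists_enumeration_ne_one hu.finite_range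
  simp_rw [fun γ : Config p => hu.finprod_eq hc hc1 hcu γ]
  exact Finset.measurable_fun_prod _ fun i _ => (measurable_from_nat (f := fun k => c i ^ k)).comp
    (measurable_count (hu.measurable_fiber _) (hu.bounded_fiber (hc1 i)))

variable (p) in
/-- The points whose norm has integer part `n`. -/
def shell (n : ℕ) : Set ℚ_[p] := {x | ⌊‖x‖⌋₊ = n}

theorem measurableSet_shell (n : ℕ) : MeasurableSet (shell p n) :=
  (Nat.measurable_floor.comp measurable_norm) (measurableSet_singleton n)

theorem isBounded_shell (n : ℕ) : Bornology.IsBounded (shell p n) := by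
  refine (Metric.isBounded_closedBall (x := (0 : ℚ_[p])) (r := n + 1)).subset fun x hx => ?_
  rw [mem_closedBall_zero_iff]
  have := Nat.lt_floor_add_one ‖x‖
  rw [show ⌊‖x‖⌋₊ = n from hx] at this
  exact this.le

theorem finite_shell_inter {B : Set ℚ_[p]} (hB : Bornology.IsBounded B) :
    {n | (shell p n ∩ B).Nonempty}.Finite := by
  obtain ⟨R, hR⟩ := hB.subset_closedBall 0
  refine (Set.finite_Iic ⌊R⌋₊).subset ?_
  rintro n ⟨x, hx, hxB⟩
  have h1 := mem_closedBall_zero_iff.1 (hR hxB)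
  rw [Set.mem_Iic, ← show ⌊‖x‖⌋₊ = n from hx]
  exact Nat.floor_le_floor h1

/-- Existence of the Poisson measure with an atomless intensity. -/
theorem exists_isPoisson {σ : Measure ℚ_[p]} [NullSingletonClass σ]
    (hσ : ∀ Λ : Set ℚ_[p], Bornology.IsBounded Λ → σ Λ ≠ ⊤) :
    ∃ π : Measure (Config p), IsPoisson σ π := by
  classical
  let A : {n : ℕ // σ (shell p n) ≠ 0} → Set ℚ_[p] := fun i => shell p i.1
  have hAm : ∀ i, MeasurableSet (A i) := fun i => measurableSet_shell _
  have hA : Pairwise fun i j => Disjoint (A i) (A j) := by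
    intro i j hij
    rw [Set.disjoint_left]
    intro x hi hj
    exact hij (Subtype.ext ((show ⌊‖x‖⌋₊ = i.1 from hi).symm.trans hj))
  have hloc : ∀ B : Set ℚ_[p], Bornology.IsBounded B → {i | (A i ∩ B).Nonempty}.Finite :=
    fun B hB => by
      have h := (finite_shell_inter hB).preimage
        (Subtype.val_injective (p := fun n => σ (shell p n) ≠ 0)).injOn
      exact h
  have hAfin : ∀ i, σ (A i) ≠ ⊤ := fun i => hσ _ (isBounded_shell _)
  let ν : {n : ℕ // σ (shell p n) ≠ 0} → Measure ℚ_[p] := fun i => cond σ (A i)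
  have hprob : ∀ i, IsProbabilityMeasure (ν i) := fun i =>
    cond_isProbabilityMeasure_of_finite i.2 (hAfin i)
  have hatom : ∀ i, NullSingletonClass (ν i) := fun i =>
    ⟨fun x => cond_absolutelyContinuous (measure_singleton x)⟩
  have hν : ∀ i, ∀ᵐ x ∂(ν i), x ∈ A i := fun i => ae_cond_mem (hAm i)
  let r : {n : ℕ // σ (shell p n) ≠ 0} → NNReal := fun i => (σ (A i)).toNNReal
  set P := Measure.infinitePi fun i => samplesMeasure (r i) (ν i)
  have := Measure.isProbabilityMeasure_map (μ := P)
    (measurable_sampleConfig hloc hAm hA).aemeasurable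
  refine ⟨P.map (sampleConfig hloc), isPoisson_of_integral_finprod hσ fun u hu hu1 => ?_⟩
  rw [integral_finprod_sampleConfig hloc hAm hA hν hu hu.measurable hu1
    hu.measurable_finprod.aestronglyMeasurable, ← Complex.exp_sum]
  congr 1
  have hui := hu.integrable_sub_one hσ
  have hunion : ∫ x, (u x - 1) ∂σ =
      ∫ x in ⋃ i ∈ (hloc _ hu.bounded).toFinset, A i, (u x - 1) ∂σ := by
    refine (setIntegral_eq_integral_of_ae_compl_eq_zero ?_).symm
    have hnull : ∀ᵐ x ∂σ, ∀ n, σ (shell p n) = 0 → x ∉ shell p n := by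
      rw [ae_all_iff]
      intro n
      by_cases hn : σ (shell p n) = 0
      · filter_upwards [measure_eq_zero_iff_ae_notMem.1 hn] with x hx _ using hx
      · exact Filter.Eventually.of_forall fun x h => absurd h hn
    filter_upwards [hnull] with x hx hxU
    by_contra hne
    have hne' : u x ≠ 1 := fun h => hne (by rw [h, sub_self])
    refine hxU (Set.mem_iUnion₂.2 ⟨⟨⌊‖x‖⌋₊, fun h0 => hx _ h0 rfl⟩, ?_, rfl⟩)
    exact (hloc _ hu.bounded).mem_toFinset.2 ⟨x, rfl, hne'⟩
  rw [hunion, integral_biUnion_finset _ (fun i _ => hAm i) (fun i _ j _ hij => hA hij)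
    (fun i _ => hui.integrableOn)]
  refine Finset.sum_congr rfl fun i _ => ?_
  have hr : ((σ (A i)).toReal : ℂ) ≠ 0 := by
    exact_mod_cast (ENNReal.toReal_pos i.2 (hAfin i)).ne'
  have huint : IntegrableOn u (A i) σ := by
    have := hui.integrableOn.add (integrableOn_const (C := (1 : ℂ)) (hAfin i))
    refine this.congr (Filter.Eventually.of_forall fun x => ?_)
    simp
  rw [integral_sub huint (integrableOn_const (hAfin i)), setIntegral_const, mul_sub, mul_one]
  congr 1
  · simp only [ν, ProbabilityTheory.cond]
    rw [integral_smul_measure, Complex.real_smul, ENNReal.toReal_inv]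
    push_cast
    rw [← mul_assoc]
    exact (congrArg (· * _) (mul_inv_cancel₀ hr)).trans (one_mul _)
  · rw [Complex.real_smul, mul_one]
    rfl

instance : Measure.IsAddHaarMeasure (haar p) := by
  unfold haar
  infer_instance

instance : Measure.Regular (haar p) := by
  unfold haar
  infer_instance

theorem haar_ne_top {Λ : Set ℚ_[p]} (h : Bornology.IsBounded Λ) : haar p Λ ≠ ⊤ :=
  h.measure_lt_top.ne

open scoped Pointwise in
/-- The image of Haar measure under an affine map is a multiple of Haar measure. -/
theorem exists_haar_preimage_affine :
    ∃ κ : ℚ_[p] → NNReal, κ 1 = 1 ∧ ∀ a : ℚ_[p], a ≠ 0 → ∀ (b : ℚ_[p]) (S : Set ℚ_[p]),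
      haar p ((fun x => (x + b) / a) ⁻¹' S) = κ a * haar p S := by
  classical
  refine ⟨fun a => if h : a = 0 then 0 else distribHaarChar ℚ_[p] (Units.mk0 a h), ?_, ?_⟩
  · simp
  · intro a ha b S
    beta_reduce
    rw [dif_neg ha, distribHaarChar_mul]
    have h1 : (fun x : ℚ_[p] => (x + b) / a) ⁻¹' S = (fun x => x + b) ⁻¹' (Units.mk0 a ha • S) := by
      ext x
      rw [Set.mem_preimage, Set.mem_preimage, Set.mem_smul_set_iff_inv_smul_mem, div_eq_inv_mul]
      rfl
    rw [h1, measure_preimage_add_right]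

namespace Aff

variable (g : Aff p)

/-- The pair of coefficient functions. -/
def coeff (x : ℚ_[p]) : ℚ_[p] × ℚ_[p] := (g.a x, g.b x)

theorem isLocallyConstant_coeff : IsLocallyConstant g.coeff :=
  g.a_locallyConstant.prodMk g.b_test.locallyConstant

/-- A compact set off which the motion is trivial. -/
def core : Set ℚ_[p] := mulTSupport g.a ∪ tsupport g.b

theorem isCompact_core : IsCompact g.core :=
  g.a_eq_one.isCompact.union g.b_test.compactSupport.isCompact

theorem coeff_of_notMem_core {x : ℚ_[p]} (hx : x ∉ g.core) : g.coeff x = (1, 0) := by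
  have h1 : x ∉ mulTSupport g.a := fun h => hx (Or.inl h)
  have h2 : x ∉ tsupport g.b := fun h => hx (Or.inr h)
  rw [coeff, image_eq_one_of_notMem_mulTSupport h1, image_eq_zero_of_notMem_tsupport h2]

theorem act_eq_of_coeff {x : ℚ_[p]} {c : ℚ_[p] × ℚ_[p]} (h : g.coeff x = c) :
    g.act x = (x + c.2) / c.1 := by
  rw [← h]
  rfl

theorem act_of_notMem_core {x : ℚ_[p]} (hx : x ∉ g.core) : g.act x = x := by
  rw [g.act_eq_of_coeff (g.coeff_of_notMem_core hx), add_zero, div_one]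

theorem finite_range_coeff : (Set.range g.coeff).Finite := by
  let _ : TopologicalSpace (ℚ_[p] × ℚ_[p]) := ⊥
  have : DiscreteTopology (ℚ_[p] × ℚ_[p]) := ⟨rfl⟩
  have h1 : (g.coeff '' g.core).Finite :=
    (g.isCompact_core.image g.isLocallyConstant_coeff.continuous).finite_of_discrete
  refine (h1.insert (1, 0)).subset ?_
  rintro _ ⟨x, rfl⟩
  by_cases hx : x ∈ g.core
  · exact Or.inr ⟨x, hx, rfl⟩
  · exact Or.inl (g.coeff_of_notMem_core hx)

theorem continuous_act : Continuous g.act :=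
  (continuous_id.add g.b_test.locallyConstant.continuous).div g.a_locallyConstant.continuous
    g.a_ne_zero

theorem isBounded_preimage_act {B : Set ℚ_[p]} (hB : Bornology.IsBounded B) :
    Bornology.IsBounded (g.act ⁻¹' B) := by
  refine (g.isCompact_core.isBounded.union hB).subset fun x hx => ?_
  by_cases h : x ∈ g.core
  · exact Or.inl h
  · right
    rw [Set.mem_preimage, g.act_of_notMem_core h] at hx
    exact hx

theorem dual_apply {S : Set ℚ_[p]} (hS : MeasurableSet S) :
    g.dual (haar p) S = haar p (g.act ⁻¹' S) :=
  Measure.map_apply g.continuous_act.measurable hS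

theorem dual_ne_top {Λ : Set ℚ_[p]} (h : Bornology.IsBounded Λ) : g.dual (haar p) Λ ≠ ⊤ := by
  refine ne_top_of_le_ne_top ?_ (measure_mono (subset_closure (s := Λ)))
  rw [g.dual_apply isClosed_closure.measurableSet]
  exact haar_ne_top (g.isBounded_preimage_act h.closure)

/-- The points reached by the branch of the motion with coefficients `c`. -/
def branchImage (c : ℚ_[p] × ℚ_[p]) : Set ℚ_[p] := {y | g.coeff (c.1 * y - c.2) = c}

theorem measurableSet_branchImage (c : ℚ_[p] × ℚ_[p]) : MeasurableSet (g.branchImage c) :=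
  ((g.isLocallyConstant_coeff.isOpen_fiber c).preimage
    (f := fun y => c.1 * y - c.2) (by fun_prop)).measurableSet

theorem preimage_act_inter_fiber {c : ℚ_[p] × ℚ_[p]} (hc : c.1 ≠ 0) (S : Set ℚ_[p]) :
    g.act ⁻¹' S ∩ g.coeff ⁻¹' {c} =
      (fun x => (x + c.2) / c.1) ⁻¹' (S ∩ g.branchImage c) := by
  ext x
  have hx : c.1 * ((x + c.2) / c.1) - c.2 = x := by
    field_simp
    ring
  simp only [Set.mem_inter_iff, Set.mem_preimage, Set.mem_singleton_iff, branchImage,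
    Set.mem_ofPred_eq, hx]
  constructor
  · rintro ⟨h1, h2⟩
    exact ⟨g.act_eq_of_coeff h2 ▸ h1, h2⟩
  · rintro ⟨h1, h2⟩
    exact ⟨(g.act_eq_of_coeff h2).symm ▸ h1, h2⟩

/-- The image of Haar measure under the motion has a locally constant density which is `1` off a
compact set. -/
theorem exists_density : ∃ ρ : ℚ_[p] → ℝ,
    (∃ R : ℝ, 0 < R ∧ ∃ r : ℚ_[p] → ℝ, IsTest r ∧ (∀ x, 0 ≤ r x) ∧
      ∀ x, ρ x = Set.indicator {y : ℚ_[p] | R < ‖y‖} 1 x + r x) ∧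
    g.dual (haar p) = (haar p).withDensity fun x => ENNReal.ofReal (ρ x) := by
  classical
  obtain ⟨κ, hκ1, hκ⟩ := exists_haar_preimage_affine (p := p)
  set C : Finset (ℚ_[p] × ℚ_[p]) := g.finite_range_coeff.toFinset with hC
  have hCmem : ∀ x, g.coeff x ∈ C := fun x => by simp [hC]
  have hC0 : ∀ c ∈ C, c.1 ≠ 0 := by
    intro c hc
    obtain ⟨x, rfl⟩ := g.finite_range_coeff.mem_toFinset.1 hc
    exact g.a_ne_zero x
  set ρ : ℚ_[p] → ℝ := fun y => ∑ c ∈ C, (g.branchImage c).indicator (fun _ => (κ c.1 : ℝ)) y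
    with hρ
  have hρ0 : ∀ y, 0 ≤ ρ y := fun y => Finset.sum_nonneg fun c _ =>
    Set.indicator_nonneg (fun _ _ => NNReal.coe_nonneg _) y
  have hρlc : IsLocallyConstant ρ := by
    rw [IsLocallyConstant.iff_eventually_eq]
    intro y
    have h1 : ∀ᶠ y' in 𝓝 y, ∀ c ∈ C, g.coeff (c.1 * y' - c.2) = g.coeff (c.1 * y - c.2) := by
      rw [Filter.eventually_all_finset]
      intro c _
      have hcont : Continuous fun y : ℚ_[p] => c.1 * y - c.2 := by fun_prop
      exact hcont.continuousAt.eventually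
        (g.isLocallyConstant_coeff.eventually_eq (c.1 * y - c.2))
    filter_upwards [h1] with y' hy'
    refine Finset.sum_congr rfl fun c hc => ?_
    have : y' ∈ g.branchImage c ↔ y ∈ g.branchImage c := by
      simp only [branchImage, Set.mem_ofPred_eq, hy' c hc]
    by_cases hy : y ∈ g.branchImage c
    · rw [Set.indicator_of_mem hy, Set.indicator_of_mem (this.2 hy)]
    · rw [Set.indicator_of_notMem hy, Set.indicator_of_notMem (fun h => hy (this.1 h))]
  obtain ⟨R, hR0, hR⟩ := (g.isCompact_core.union
    (g.isCompact_core.image g.continuous_act)).isBounded.subset_closedBall_lt 0 0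
  have hρ1 : ∀ y, R < ‖y‖ → ρ y = 1 := by
    intro y hy
    have hynot : y ∉ g.core ∪ g.act '' g.core := fun h =>
      absurd (mem_closedBall_zero_iff.1 (hR h)) (not_le.2 hy)
    have hy1 : g.coeff y = (1, 0) := g.coeff_of_notMem_core fun h => hynot (Or.inl h)
    rw [hρ]
    simp only
    rw [Finset.sum_eq_single (1, 0)]
    · rw [Set.indicator_of_mem]
      · simp [hκ1]
      · simp [branchImage, hy1]
    · intro c hc hne
      refine Set.indicator_of_notMem (fun hyc => ?_) _
      have hyc' : g.coeff (c.1 * y - c.2) = c := hyc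
      have hcore : c.1 * y - c.2 ∈ g.core := by
        by_contra h
        exact hne (hyc'.symm.trans (g.coeff_of_notMem_core h))
      refine hynot (Or.inr ⟨_, hcore, ?_⟩)
      rw [g.act_eq_of_coeff hyc', sub_add_cancel, mul_div_cancel_left₀ _ (hC0 c hc)]
    · intro h
      exact absurd (hy1 ▸ hCmem y) h
  refine ⟨ρ, ⟨R, hR0, (Metric.closedBall 0 R).indicator ρ, ⟨?_, ?_⟩, ?_, ?_⟩, ?_⟩
  · rw [IsLocallyConstant.iff_eventually_eq]
    intro y
    have hop : IsOpen (Metric.closedBall (0 : ℚ_[p]) R) :=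
      IsUltrametricDist.isOpen_closedBall 0 hR0.ne'
    by_cases hy : y ∈ Metric.closedBall (0 : ℚ_[p]) R
    · filter_upwards [hop.mem_nhds hy, hρlc.eventually_eq y] with z hz hz'
      rw [Set.indicator_of_mem hz, Set.indicator_of_mem hy, hz']
    · filter_upwards [Metric.isClosed_closedBall.isOpen_compl.mem_nhds hy] with z hz
      rw [Set.indicator_of_notMem hz, Set.indicator_of_notMem hy]
  · exact HasCompactSupport.intro (isCompact_closedBall 0 R) fun x hx =>
      Set.indicator_of_notMem hx _
  · exact fun x => Set.indicator_nonneg (fun y _ => hρ0 y) x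
  · intro x
    by_cases hx : R < ‖x‖
    · rw [Set.indicator_of_mem (show x ∈ {y : ℚ_[p] | R < ‖y‖} from hx),
        Set.indicator_of_notMem (by simpa using hx), hρ1 x hx]
      simp
    · rw [Set.indicator_of_notMem (show x ∉ {y : ℚ_[p] | R < ‖y‖} from hx),
        Set.indicator_of_mem (by simpa using hx), zero_add]
  · refine Measure.ext fun S hS => ?_
    have hofReal : ∀ y, ENNReal.ofReal (ρ y) =
        ∑ c ∈ C, (g.branchImage c).indicator (fun _ => (κ c.1 : ENNReal)) y := by
      intro y
      rw [hρ]
      simp only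
      rw [ENNReal.ofReal_sum_of_nonneg fun c _ =>
        Set.indicator_nonneg (fun _ _ => NNReal.coe_nonneg _) y]
      refine Finset.sum_congr rfl fun c _ => ?_
      by_cases hy : y ∈ g.branchImage c <;> simp [hy]
    rw [withDensity_apply _ hS, g.dual_apply hS]
    simp_rw [hofReal]
    rw [lintegral_finsetSum _ fun c _ =>
      measurable_const.indicator (g.measurableSet_branchImage c)]
    have hcover : g.act ⁻¹' S = ⋃ c ∈ C, g.act ⁻¹' S ∩ g.coeff ⁻¹' {c} := by
      ext x
      simp only [Set.mem_iUnion, Set.mem_inter_iff, Set.mem_preimage, Set.mem_singleton_iff,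
        exists_prop]
      exact ⟨fun h => ⟨g.coeff x, hCmem x, h, rfl⟩, fun ⟨_, _, h, _⟩ => h⟩
    rw [hcover, measure_biUnion_finset]
    · refine Finset.sum_congr rfl fun c hc => ?_
      rw [g.preimage_act_inter_fiber (hC0 c hc), hκ c.1 (hC0 c hc),
        lintegral_indicator_const (g.measurableSet_branchImage c),
        Measure.restrict_apply (g.measurableSet_branchImage c), Set.inter_comm]
    · intro c _ d _ hcd
      exact (disjoint_preimage_singleton g.coeff hcd).mono Set.inter_subset_right
        Set.inter_subset_right
    · exact fun c _ => (g.continuous_act.measurable hS).inter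
        (g.isLocallyConstant_coeff.isOpen_fiber c).measurableSet

end Aff

theorem IsStep.comp {M N : Type*} [One M] [One N] {u : ℚ_[p] → M} (hu : IsStep u) {f : M → N}
    (hf : f 1 = 1) : IsStep fun x => f (u x) where
  finite_range := by
    have := hu.finite_range.image f
    rwa [← Set.range_comp] at this
  bounded := hu.bounded.subset fun x hx h => hx (by simp only [h, hf])
  measurable_fiber c := hu.measurableSet_preimage (f ⁻¹' {c})

theorem IsStep.mul {M : Type*} [MulOneClass M] [MeasurableSpace M] [MeasurableMul₂ M]
    [MeasurableSingletonClass M] {u v : ℚ_[p] → M} (hu : IsStep u) (hv : IsStep v) :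
    IsStep fun x => u x * v x where
  finite_range := (hu.finite_range.mul hv.finite_range).subset (by
    rintro _ ⟨x, rfl⟩
    exact Set.mul_mem_mul ⟨x, rfl⟩ ⟨x, rfl⟩)
  bounded := (hu.bounded.union hv.bounded).subset (Function.mulSupport_mul u v)
  measurable_fiber c := (hu.measurable.mul hv.measurable) (measurableSet_singleton c)

theorem isStep_one {M : Type*} [One M] : IsStep fun _ : ℚ_[p] => (1 : M) where
  finite_range := (Set.finite_singleton 1).subset (by rintro _ ⟨x, rfl⟩; rfl)
  bounded := by simp
  measurable_fiber c := MeasurableSet.const ((1 : M) ∈ ({c} : Set M))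

section tilting

variable {ρ : ℚ_[p] → ℝ}

theorem productDensity_nonneg (h0 : ∀ x, 0 ≤ ρ x) (γ : Config p) : 0 ≤ productDensity ρ γ :=
  mul_nonneg (finprod_nonneg fun x => finprod_nonneg fun _ => h0 x) (Real.exp_nonneg _)

theorem measurable_productDensity (hρ : IsStep ρ) :
    Measurable (productDensity ρ : Config p → ℝ) :=
  hρ.measurable_finprod.mul_const _

theorem productDensity_mul_finprod (hρ : IsStep ρ) {u : ℚ_[p] → ℂ} (hu : IsStep u)
    (γ : Config p) :
    (productDensity ρ γ : ℂ) * ∏ᶠ x ∈ γ.1, u x =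
      Complex.exp (∫ x, (1 - (ρ x : ℂ)) ∂(haar p)) * ∏ᶠ x ∈ γ.1, ((ρ x : ℂ) * u x) := by
  have hρ' : IsStep fun x => (ρ x : ℂ) := hρ.comp (f := Complex.ofReal) Complex.ofReal_one
  rw [finprod_mem_mul_distrib' (hρ'.finite_inter γ) (hu.finite_inter γ), productDensity]
  have h1 : ((∏ᶠ x ∈ γ.1, ρ x : ℝ) : ℂ) = ∏ᶠ x ∈ γ.1, (ρ x : ℂ) :=
    MonoidHom.map_finprod_mem' (Complex.ofRealHom : ℝ →* ℂ) (hρ.finite_inter γ)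
  have h2 : ((∫ x, (1 - ρ x) ∂(haar p) : ℝ) : ℂ) = ∫ x, (1 - (ρ x : ℂ)) ∂(haar p) := by
    rw [← integral_complex_ofReal]
    simp
  rw [Complex.ofReal_mul, h1, Complex.ofReal_exp, h2]
  ring

theorem integral_finprod_withDensity (hρ : IsStep ρ) (h0 : ∀ x, 0 ≤ ρ x)
    {π : Measure (Config p)} (hπ : IsPoisson (haar p) π) {u : ℚ_[p] → ℂ} (hu : IsStep u) :
    ∫ γ, ∏ᶠ x ∈ γ.1, u x ∂(π.withDensity fun γ => ENNReal.ofReal (productDensity ρ γ)) =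
      Complex.exp (∫ x, (u x - 1) ∂((haar p).withDensity fun x => ENNReal.ofReal (ρ x))) := by
  have hρ' : IsStep fun x => (ρ x : ℂ) := hρ.comp (f := Complex.ofReal) Complex.ofReal_one
  have hρu := hρ'.mul hu
  have hfin : ∀ Λ : Set ℚ_[p], Bornology.IsBounded Λ → haar p Λ ≠ ⊤ := fun _ h => haar_ne_top h
  rw [integral_withDensity_eq_integral_toReal_smul
    (measurable_productDensity hρ).ennreal_ofReal (Filter.Eventually.of_forall fun _ => by simp),
    integral_withDensity_eq_integral_toReal_smul
    hρ.measurable.ennreal_ofReal (Filter.Eventually.of_forall fun _ => by simp)]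
  simp_rw [ENNReal.toReal_ofReal (productDensity_nonneg h0 _), ENNReal.toReal_ofReal (h0 _),
    Complex.real_smul, productDensity_mul_finprod hρ hu]
  rw [integral_const_mul, (hπ.integral_finprod hfin hρu).2, ← Complex.exp_add,
    ← integral_add _ (hρu.integrable_sub_one hfin)]
  · congr 2
    funext x
    ring
  · have := (hρ'.integrable_sub_one hfin).neg
    refine this.congr (Filter.Eventually.of_forall fun x => ?_)
    simp

/-- Tilting a Poisson measure by `productDensity ρ` multiplies the intensity by `ρ`. -/
theorem IsPoisson.withDensity (hρ : IsStep ρ) (h0 : ∀ x, 0 ≤ ρ x)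
    (hfin : ∀ Λ : Set ℚ_[p], Bornology.IsBounded Λ →
      (haar p).withDensity (fun x => ENNReal.ofReal (ρ x)) Λ ≠ ⊤)
    {π : Measure (Config p)} (hπ : IsPoisson (haar p) π) :
    IsPoisson ((haar p).withDensity fun x => ENNReal.ofReal (ρ x))
      (π.withDensity fun γ => ENNReal.ofReal (productDensity ρ γ)) := by
  have hprob : IsProbabilityMeasure
      (π.withDensity fun γ => ENNReal.ofReal (productDensity ρ γ)) := by
    have h := integral_finprod_withDensity hρ h0 hπ (u := fun _ => 1) isStep_one
    simp only [finprod_mem_one, sub_self, integral_zero, Complex.exp_zero, integral_const,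
      Complex.real_smul, mul_one, Complex.ofReal_eq_one] at h
    exact ⟨(ENNReal.toReal_eq_one_iff _).1 h⟩
  exact isPoisson_of_integral_finprod hfin fun u hu _ => integral_finprod_withDensity hρ h0 hπ hu

end tilting

section cylinder

theorem pairing_pi_eq {E : Type*} [AddCommMonoid E] {n m : ℕ} {f : Fin n → ℚ_[p] → E}
    {c : Fin m → Fin n → E} (hc : Function.Injective c) (hc0 : ∀ i, c i ≠ 0)
    (hcf : ∀ x, (fun j => f j x) ≠ 0 → ∃ i, c i = fun j => f j x)
    (hb : Bornology.IsBounded (Function.support fun x j => f j x)) (γ : Config p) :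
    (fun j => pairing (f j) γ) = ∑ i, count ((fun x j => f j x) ⁻¹' {c i}) γ • c i := by
  have h := finsum_mem_eq_sum_nsmul_ncard (s := γ.1) (u := fun x j => f j x) hc
    (γ.finite_inter hb) hc0 hcf
  simp only [count]
  rw [← h]
  funext j
  exact (AddMonoidHom.map_finsum_mem' (Pi.evalAddMonoidHom (fun _ : Fin n => E) j)
    (f := fun x j => f j x) (γ.finite_inter hb)).symm

theorem isTest_pi {E : Type*} [Zero E] {n : ℕ} {f : Fin n → ℚ_[p] → E}
    (hf : ∀ j, IsTest (f j)) : IsTest fun x j => f j x := by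
  refine ⟨?_, ?_⟩
  · rw [IsLocallyConstant.iff_eventually_eq]
    intro x
    filter_upwards [Filter.eventually_all.2 fun j => (hf j).locallyConstant.eventually_eq x]
      with y hy
    exact funext hy
  · refine HasCompactSupport.intro (isCompact_iUnion fun j => (hf j).compactSupport.isCompact)
      fun x hx => ?_
    funext j
    exact image_eq_zero_of_notMem_tsupport fun h => hx (Set.mem_iUnion.2 ⟨j, h⟩)

/-- Cylinder functions and their images under the motion are the same function of counts with the
same joint law. -/
theorem exists_common_law {E : Type*} [AddCommMonoid E] (g : Aff p) {π π' : Measure (Config p)}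
    (hπ : IsPoisson (haar p) π) (hπ' : IsPoisson (g.dual (haar p)) π') {n : ℕ}
    {f : Fin n → ℚ_[p] → E} (hf : ∀ j, IsTest (f j)) :
    ∃ (m : ℕ) (c : Fin m → Fin n → E) (r : Fin m → NNReal) (X Y : Config p → Fin m → ℕ),
      Measurable X ∧ Measurable Y ∧
      π.map X = Measure.pi (fun i => poissonMeasure (r i)) ∧
      π'.map Y = Measure.pi (fun i => poissonMeasure (r i)) ∧
      (∀ ψ : (Fin n → E) → ℂ, moveCyl g f ψ = (fun k => ψ (∑ i, k i • c i)) ∘ X) ∧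
      ∀ ψ : (Fin n → E) → ℂ, cyl f ψ = (fun k => ψ (∑ i, k i • c i)) ∘ Y := by
  have hF := isTest_pi hf
  set F : ℚ_[p] → Fin n → E := fun x j => f j x with hFdef
  obtain ⟨m, c, hc, hc0, hcF⟩ := exists_enumeration_ne_zero (isTest_finite_range hF)
  have hm : ∀ i, MeasurableSet (F ⁻¹' {c i}) := fun i =>
    (hF.locallyConstant.isOpen_fiber (c i)).measurableSet
  have hb : ∀ i, Bornology.IsBounded (F ⁻¹' {c i}) := fun i =>
    (hF.isCompact_fiber (hc0 i)).isBounded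
  have hd : ∀ i j, i ≠ j → Disjoint (F ⁻¹' {c i}) (F ⁻¹' {c j}) := fun i j hij =>
    disjoint_preimage_singleton F (hc.ne hij)
  have hm' : ∀ i, MeasurableSet (g.act ⁻¹' (F ⁻¹' {c i})) := fun i =>
    g.continuous_act.measurable (hm i)
  have hb' : ∀ i, Bornology.IsBounded (g.act ⁻¹' (F ⁻¹' {c i})) := fun i =>
    g.isBounded_preimage_act (hb i)
  have hd' : ∀ i j, i ≠ j →
      Disjoint (g.act ⁻¹' (F ⁻¹' {c i})) (g.act ⁻¹' (F ⁻¹' {c j})) := fun i j hij =>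
    (hd i j hij).preimage _
  have hsupp : Bornology.IsBounded (Function.support F) :=
    hF.compactSupport.isCompact.isBounded.subset (subset_tsupport _)
  refine ⟨m, c, fun i => (haar p (g.act ⁻¹' (F ⁻¹' {c i}))).toNNReal,
    fun γ i => count (g.act ⁻¹' (F ⁻¹' {c i})) γ, fun γ i => count (F ⁻¹' {c i}) γ,
    measurable_counts hm' hb', measurable_counts hm hb, hπ.map_counts hm' hb' hd', ?_, ?_, ?_⟩
  · rw [hπ'.map_counts hm hb hd]
    simp_rw [g.dual_apply (hm _)]
  · intro ψ
    funext γ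
    refine congrArg ψ (pairing_pi_eq (f := fun j x => f j (g.act x)) hc hc0
      (fun x hx => hcF (g.act x) hx) ?_ γ)
    exact g.isBounded_preimage_act hsupp
  · intro ψ
    funext γ
    exact congrArg ψ (pairing_pi_eq hc hc0 hcF hsupp γ)

/-- A polynomial in linear combinations of natural numbers grows at most exponentially. -/
theorem exists_exponential_bound {n m : ℕ} (c : Fin m → Fin n → ℂ)
    (P : MvPolynomial (Fin n) ℂ) :
    ∃ C z : ℝ, 0 ≤ C ∧ 1 ≤ z ∧ ∀ k : Fin m → ℕ,
      ‖MvPolynomial.eval (∑ i, k i • c i) P‖ ≤ C * ∏ i, z ^ k i := by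
  induction P using MvPolynomial.induction_on with
  | C a => exact ⟨‖a‖, 1, norm_nonneg _, le_rfl, fun k => by simp⟩
  | add P Q hP hQ =>
    obtain ⟨C, z, hC, hz, h⟩ := hP
    obtain ⟨C', z', hC', hz', h'⟩ := hQ
    refine ⟨C + C', z * z', by positivity, one_le_mul_of_one_le_of_one_le hz hz', fun k => ?_⟩
    have h0 : 0 ≤ z := zero_le_one.trans hz
    have h0' : 0 ≤ z' := zero_le_one.trans hz'
    have h1 : ∏ i, z ^ k i ≤ ∏ i, (z * z') ^ k i :=
      Finset.prod_le_prod (fun i _ => pow_nonneg h0 _)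
        (fun i _ => pow_le_pow_left₀ h0 (le_mul_of_one_le_right h0 hz') _)
    have h2 : ∏ i, z' ^ k i ≤ ∏ i, (z * z') ^ k i :=
      Finset.prod_le_prod (fun i _ => pow_nonneg h0' _)
        (fun i _ => pow_le_pow_left₀ h0' (le_mul_of_one_le_left h0' hz) _)
    rw [map_add, add_mul]
    exact (norm_add_le _ _).trans (add_le_add ((h k).trans (mul_le_mul_of_nonneg_left h1 hC))
      ((h' k).trans (mul_le_mul_of_nonneg_left h2 hC')))
  | mul_X P j hP =>
    obtain ⟨C, z, hC, hz, h⟩ := hP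
    have h0 : 0 ≤ z := zero_le_one.trans hz
    refine ⟨C * ∑ i, ‖c i j‖, z * 2, by positivity, by linarith, fun k => ?_⟩
    have h1 : ‖(∑ i, k i • c i) j‖ ≤ (∑ i, ‖c i j‖) * ∏ i, (2 : ℝ) ^ k i := by
      rw [Finset.sum_apply, Finset.sum_mul]
      refine (norm_sum_le _ _).trans (Finset.sum_le_sum fun i _ => ?_)
      have h2 : (k i : ℝ) ≤ ∏ i, (2 : ℝ) ^ k i := by
        have h3 : (k i : ℝ) ≤ 2 ^ k i := by exact_mod_cast (Nat.lt_two_pow_self (n := k i)).le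
        rw [Finset.prod_pow_eq_pow_sum]
        exact h3.trans (pow_le_pow_right₀ one_le_two
          (Finset.single_le_sum (fun _ _ => Nat.zero_le _) (Finset.mem_univ i)))
      rw [Pi.smul_apply, nsmul_eq_mul, norm_mul, Complex.norm_natCast, mul_comm]
      exact mul_le_mul_of_nonneg_left h2 (norm_nonneg _)
    rw [map_mul, MvPolynomial.eval_X, norm_mul]
    calc _ ≤ (C * ∏ i, z ^ k i) * ((∑ i, ‖c i j‖) * ∏ i, (2 : ℝ) ^ k i) :=
          mul_le_mul (h k) h1 (norm_nonneg _)
            (mul_nonneg hC (Finset.prod_nonneg fun i _ => pow_nonneg h0 _))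
      _ = C * (∑ i, ‖c i j‖) * ∏ i, (z * 2) ^ k i := by
          simp_rw [mul_pow, Finset.prod_mul_distrib]
          ring

theorem integrable_polynomial_pi_poisson {n m : ℕ} (c : Fin m → Fin n → ℂ)
    (P : MvPolynomial (Fin n) ℂ) (r : Fin m → NNReal) :
    Integrable (fun k : Fin m → ℕ => MvPolynomial.eval (∑ i, k i • c i) P)
      (Measure.pi fun i => poissonMeasure (r i)) := by
  obtain ⟨C, z, hC, hz, h⟩ := exists_exponential_bound c P
  have h0 : 0 ≤ z := zero_le_one.trans hz
  have hint : Integrable (fun k : Fin m → ℕ => ∏ i, (z : ℂ) ^ k i)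
      (Measure.pi fun i => poissonMeasure (r i)) :=
    Integrable.fintype_prod (f := fun _ k => (z : ℂ) ^ k)
      fun i => integrable_pow_poissonMeasure _ _
  refine (hint.norm.const_mul C).mono' (measurable_of_countable _).aestronglyMeasurable
    (Filter.Eventually.of_forall fun k => (h k).trans_eq ?_)
  simp [norm_prod, abs_of_nonneg h0]

theorem isDualMeasure_of_isPoisson (g : Aff p) {π π' : Measure (Config p)}
    (hπ : IsPoisson (haar p) π) (hπ' : IsPoisson (g.dual (haar p)) π') :
    IsDualMeasure g π π' := by
  refine ⟨fun n f hf ψ => ?_, fun n f hf P => ?_⟩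
  · obtain ⟨m, c, r, X, Y, hX, hY, hlX, hlY, hmove, hcyl⟩ := exists_common_law g hπ hπ' hf
    rw [hmove, hcyl]
    have hsm : ∀ μ : Measure (Fin m → ℕ), AEStronglyMeasurable
        (fun k : Fin m → ℕ => ψ (∑ i, k i • c i)) μ := fun μ =>
      (measurable_of_countable _).aestronglyMeasurable
    have h1 := integral_map hX.aemeasurable (hsm (π.map X))
    have h2 := integral_map hY.aemeasurable (hsm (π'.map Y))
    rw [hlX] at h1
    rw [hlY] at h2
    exact h1.symm.trans h2
  · obtain ⟨m, c, r, X, Y, hX, hY, hlX, hlY, hmove, hcyl⟩ := exists_common_law g hπ hπ' hf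
    rw [hmove, hcyl]
    have hsm : ∀ μ : Measure (Fin m → ℕ), AEStronglyMeasurable
        (fun k : Fin m → ℕ => MvPolynomial.eval (∑ i, k i • c i) P) μ := fun μ =>
      (measurable_of_countable _).aestronglyMeasurable
    have h1 := integral_map hX.aemeasurable (hsm (π.map X))
    have h2 := integral_map hY.aemeasurable (hsm (π'.map Y))
    rw [hlX] at h1
    rw [hlY] at h2
    have hint := integrable_polynomial_pi_poisson c P r
    refine ⟨?_, ?_, h1.symm.trans h2⟩
    · rw [← integrable_map_measure (hsm _) hX.aemeasurable, hlX]
      exact hint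
    · rw [← integrable_map_measure (hsm _) hY.aemeasurable, hlY]
      exact hint

/-- The dual measure is unique. -/
theorem IsDualMeasure.unique {g : Aff p} {π ν ν' : Measure (Config p)} [IsProbabilityMeasure π]
    (hν : IsDualMeasure g π ν) (hν' : IsDualMeasure g π ν') : ν = ν' := by
  classical
  have hprob : ∀ μ, IsDualMeasure g π μ → IsProbabilityMeasure μ := by
    intro μ hμ
    have h := hμ.bounded 0 (fun j => 0) (fun j => j.elim0) (BoundedContinuousFunction.const _ 1)
    simp only [moveCyl, cyl, BoundedContinuousFunction.const_apply, integral_const,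
      probReal_univ, one_smul, Complex.real_smul, mul_one] at h
    exact ⟨(ENNReal.toReal_eq_one_iff _).1 (by exact_mod_cast h.symm)⟩
  have := hprob ν hν
  have := hprob ν' hν'
  refine ext_of_integral_finprod_phase fun I t => ?_
  let e := I.equivFin
  let ψ : BoundedContinuousFunction (Fin I.card → ℝ) ℂ :=
    BoundedContinuousFunction.ofNormedAddCommGroup
      (fun v => Complex.exp ((∑ k : I, t k * v (e k) : ℝ) * Complex.I)) (by fun_prop) 1
      (fun v => (Complex.norm_exp_ofReal_mul_I _).le)
  let f : Fin I.card → ℚ_[p] → ℝ := fun j =>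
    (ratBall p (e.symm j : I)).indicator fun _ => 1
  have hf : ∀ j, IsTest (f j) := fun j => isTest_indicator 1 (isCompact_ball _) Metric.isOpen_ball
  have hcyl : ∀ γ : Config p,
      ∏ᶠ x ∈ γ.1, phase (fun k : I => ratBall p k) t x = cyl f ψ γ := by
    intro γ
    rw [finprod_phase (fun k => isBounded_ratBall _)]
    change _ = Complex.exp ((∑ k : I, t k * pairing (f (e k)) γ : ℝ) * Complex.I)
    congr 3
    refine Finset.sum_congr rfl fun k _ => ?_
    simp only [f, Equiv.symm_apply_apply]
    rw [pairing_indicator_one (isBounded_ratBall _)]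
  simp_rw [hcyl]
  rw [← hν.bounded _ f hf ψ, ← hν'.bounded _ f hf ψ]

end cylinder

theorem isPoisson_iff_eq_poisson {σ : Measure ℚ_[p]}
    (hσ : ∀ Λ : Set ℚ_[p], Bornology.IsBounded Λ → σ Λ ≠ ⊤)
    (hex : ∃ π : Measure (Config p), IsPoisson σ π) (π : Measure (Config p)) :
    IsPoisson σ π ↔ π = poisson σ := by
  have h : IsPoisson σ (poisson σ) := Classical.epsilon_spec hex
  exact ⟨fun hπ => hπ.unique hσ h, fun hπ => hπ ▸ h⟩

open scoped Pointwise in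
/-- A density equal to `1` off a ball and locally constant on it is a step function. -/
theorem isStep_of_eq_indicator_add {ρ r : ℚ_[p] → ℝ} {R : ℝ} (hr : IsTest r)
    (h : ∀ x, ρ x = Set.indicator {y : ℚ_[p] | R < ‖y‖} 1 x + r x) : IsStep ρ where
  finite_range := by
    refine (((Set.toFinite {0, 1}).add (isTest_finite_range hr)) :
      (({0, 1} : Set ℝ) + Set.range r).Finite).subset ?_
    rintro _ ⟨x, rfl⟩
    rw [h x]
    refine Set.add_mem_add ?_ ⟨x, rfl⟩
    by_cases hx : R < ‖x‖ <;> simp [hx]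
  bounded := by
    refine ((Metric.isBounded_closedBall (x := (0 : ℚ_[p])) (r := R)).union
      hr.compactSupport.isCompact.isBounded).subset fun x hx => ?_
    by_contra hne
    simp only [Set.mem_union, mem_closedBall_zero_iff, not_or, not_le] at hne
    refine hx ?_
    rw [h x, image_eq_zero_of_notMem_tsupport hne.2, add_zero,
      Set.indicator_of_mem (show x ∈ {y : ℚ_[p] | R < ‖y‖} from hne.1), Pi.one_apply]
  measurable_fiber c := by
    have hm : Measurable ρ := by
      rw [funext h]
      exact (measurable_one.indicator (measurableSet_lt measurable_const measurable_norm)).add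
        hr.locallyConstant.continuous.measurable
    exact hm (measurableSet_singleton c)

end PadicPoisson
end

theorem mainTheorem2 (p : ℕ) [Fact p.Prime] :
    -- `π_m` is the unique Poisson measure with intensity `m`
    (∀ π : Measure (PadicPoisson.Config p),
      PadicPoisson.IsPoisson (PadicPoisson.haar p) π ↔
        π = PadicPoisson.poisson (PadicPoisson.haar p)) ∧
    ∀ g : PadicPoisson.Aff p,
      -- `π_{g^* m}` is the unique Poisson measure with intensity `g^* m`
      (∀ π : Measure (PadicPoisson.Config p),
        PadicPoisson.IsPoisson (g.dual (PadicPoisson.haar p)) π ↔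
          π = PadicPoisson.poisson (g.dual (PadicPoisson.haar p))) ∧
      -- `V_g^* π_m = π_{g^* m}`
      (∀ ν : Measure (PadicPoisson.Config p),
        PadicPoisson.IsDualMeasure g (PadicPoisson.poisson (PadicPoisson.haar p)) ν ↔
          ν = PadicPoisson.poisson (g.dual (PadicPoisson.haar p))) ∧
      -- absolute continuity, with Radon-Nikodym derivative in `L^1(π_m)`
      PadicPoisson.poisson (g.dual (PadicPoisson.haar p)) ≪
        PadicPoisson.poisson (PadicPoisson.haar p) ∧
      Integrable
        (fun γ => ((PadicPoisson.poisson (g.dual (PadicPoisson.haar p))).rnDeriv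
          (PadicPoisson.poisson (PadicPoisson.haar p)) γ).toReal)
        (PadicPoisson.poisson (PadicPoisson.haar p)) ∧
      -- the density `ρ_g` of `g^* m` and the explicit form of the derivative
      ∃ ρ : ℚ_[p] → ℝ,
        (∃ R : ℝ, 0 < R ∧ ∃ r : ℚ_[p] → ℝ, PadicPoisson.IsTest r ∧ (∀ x, 0 ≤ r x) ∧
          ∀ x, ρ x = Set.indicator {y : ℚ_[p] | R < ‖y‖} 1 x + r x) ∧
        g.dual (PadicPoisson.haar p) =
          (PadicPoisson.haar p).withDensity (fun x => ENNReal.ofReal (ρ x)) ∧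
        Integrable (fun x => 1 - ρ x) (PadicPoisson.haar p) ∧
        (∀ γ : PadicPoisson.Config p, {x ∈ γ.1 | ρ x ≠ 1}.Finite) ∧
        (PadicPoisson.poisson (g.dual (PadicPoisson.haar p))).rnDeriv
            (PadicPoisson.poisson (PadicPoisson.haar p))
          =ᵐ[PadicPoisson.poisson (PadicPoisson.haar p)]
          fun γ => ENNReal.ofReal (PadicPoisson.productDensity ρ γ) := by
  have hm : ∀ Λ : Set ℚ_[p], Bornology.IsBounded Λ → PadicPoisson.haar p Λ ≠ ⊤ :=
    fun _ h => PadicPoisson.haar_ne_top h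
  have hπ := PadicPoisson.isPoisson_iff_eq_poisson hm (PadicPoisson.exists_isPoisson hm)
  have hπm := (hπ _).2 rfl
  have := hπm.prob
  refine ⟨hπ, fun g => ?_⟩
  obtain ⟨ρ, ⟨R, hR, r, hr, hr0, hρr⟩, hdual⟩ := g.exists_density
  have hstep : PadicPoisson.IsStep ρ := PadicPoisson.isStep_of_eq_indicator_add hr hρr
  have hρ0 : ∀ x, 0 ≤ ρ x := fun x => by
    rw [hρr x]
    exact add_nonneg (Set.indicator_nonneg (fun _ _ => zero_le_one) x) (hr0 x)
  have hg : ∀ Λ : Set ℚ_[p], Bornology.IsBounded Λ → g.dual (PadicPoisson.haar p) Λ ≠ ⊤ :=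
    fun _ h => g.dual_ne_top h
  have htilt : PadicPoisson.IsPoisson (g.dual (PadicPoisson.haar p))
      ((PadicPoisson.poisson (PadicPoisson.haar p)).withDensity
        fun γ => ENNReal.ofReal (PadicPoisson.productDensity ρ γ)) := by
    rw [hdual] at hg ⊢
    exact hπm.withDensity hstep hρ0 hg
  have hπ' := PadicPoisson.isPoisson_iff_eq_poisson hg ⟨_, htilt⟩
  have hπg := (hπ' _).2 rfl
  have := hπg.prob
  have heq := (hπ' _).1 htilt
  have hdualM := PadicPoisson.isDualMeasure_of_isPoisson g hπm hπg
  refine ⟨hπ', fun ν => ⟨fun hν => hν.unique hdualM, fun hν => hν ▸ hdualM⟩, ?_,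
    Measure.integrable_toReal_rnDeriv, ρ, ⟨R, hR, r, hr, hr0, hρr⟩, hdual, ?_,
    fun γ => hstep.finite_inter γ, ?_⟩
  · rw [← heq]
    exact withDensity_absolutelyContinuous _ _
  · have h := ((hstep.comp (f := Complex.ofReal)
      Complex.ofReal_one).integrable_sub_one hm).re.neg
    refine h.congr (Filter.Eventually.of_forall fun x => ?_)
    simp
  · rw [← heq]
    exact Measure.rnDeriv_withDensity _
      (PadicPoisson.measurable_productDensity hstep).ennreal_ofReal
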